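/- Let $d\ge 1$, let $\Omega\subset\mathbb R^d$ be a bounded domain (non-empty, open, connected) with a Lipschitz boundary, and let $0<s\le 1$ and $1<p<\infty$ satisfy $sp>d$. Let $W^{s,p}(\Omega)$ be the Sobolev space of all $u\in L^p(\Omega)$ with $|u|_{s,p}<\infty$, normed by $(\|u\|_{L^p(\Omega)}^p+|u|_{s,p}^p)^{1/p}$, where $$|u|_{s,p}^p=\int_\Omega\int_\Omega\frac{|u(x)-u(y)|^p}{|x-y|^{d+sp}}\,dx\,dy\quad(0<s<1),\qquad |u|_{1,p}=\|\nabla u\|_{L^p(\Omega)}$$ with the weak gradient $\nabla u$ (and $|u|_{1,p}=\infty$ if there is no weak gradient in $L^p(\Omega)$). Let $$M=\{q\in L^\infty(\Omega) : -1\le q\le 1 \text{ a.e. in }\Omega\},$$ regarded as a subset of the dual space $W^{s,p}(\Omega)^\star$ by identifying $q$ with the functional $v\mapsto\int_\Omega q\,v\,dx$. Then $M$ is a closed, convex and non-empty subset of $W^{s,p}(\Omega)^\star$ which is not polyhedric. Here a closed, convex, non-empty subset $K$ of a Banach space $W$ is called polyhedric if, for every $w\in K$ and every $\eta\in\mathcal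 N_K(w)$, $$\mathcal T_K(w)\cap\ker\eta=\overline{\mathcal R_K(w)\cap\ker\eta},$$ where $\mathcal R_K(w)=\{t(k-w): t>0,\ k\in K\}$, $\mathcal T_K(w)=\overline{\mathcal R_K(w)}$ and $\mathcal N_K(w)=\{\eta\in W^\star : \eta(x)\le 0 \text{ for all } x\in\mathcal T_K(w)\}$ are the radial, tangent and normal cones. -/

import Mathlib

open MeasureTheory Set Filter Topology
open scoped ENNReal ContDiff

noncomputable section

/-! ### Cones and polyhedric sets -/

section Cones

variable {W : Type*} [NormedAddCommGroup W] [NormedSpace ℝ W]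

/-- The radial cone `ℝ⁺ (K - w)`. -/
def radialCone (K : Set W) (w : W) : Set W :=
  {x | ∃ t : ℝ, 0 < t ∧ ∃ k ∈ K, x = t • (k - w)}

/-- The tangent cone: the closure of the radial cone. -/
def tangentCone (K : Set W) (w : W) : Set W :=
  closure (radialCone K w)

/-- The polar cone of `C`, a subset of the dual space. -/
def polarCone (C : Set W) : Set (StrongDual ℝ W) :=
  {η | ∀ x ∈ C, η x ≤ 0}

/-- The normal cone: the polar of the tangent cone. -/
def normalCone (K : Set W) (w : W) : Set (StrongDual ℝ W) :=
  polarCone (tangentCone K w)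

/-- The kernel of a functional. -/
def annihilator (η : StrongDual ℝ W) : Set W :=
  {x | η x = 0}

/-- `K` is polyhedric at `w` with respect to `η`. -/
def IsPolyhedricAt (K : Set W) (w : W) (η : StrongDual ℝ W) : Prop :=
  tangentCone K w ∩ annihilator η = closure (radialCone K w ∩ annihilator η)

/-- `K` (understood to be closed, convex and non-empty) is polyhedric. -/
def IsPolyhedric (K : Set W) : Prop :=
  ∀ w ∈ K, ∀ η ∈ normalCone K w, IsPolyhedricAt K w η

end Cones

/-! ### Bounded Lipschitz domains -/

/-- A bounded domain (non-empty, connected, open set) with a Lipschitz boundary: near each boundary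
point, in suitable Cartesian coordinates with `e` as the vertical direction, the set is the
strict supergraph of a Lipschitz function of the horizontal component `z - ⟪e, z⟫ e`. -/
structure IsBoundedLipschitzDomain {d : ℕ} (Ω : Set (EuclideanSpace ℝ (Fin d))) : Prop where
  isOpen : IsOpen Ω
  isConnected : IsConnected Ω
  isBounded : Bornology.IsBounded Ω
  lipschitz_boundary : ∀ x ∈ frontier Ω,
    ∃ e : EuclideanSpace ℝ (Fin d), ‖e‖ = 1 ∧
      ∃ (γ : EuclideanSpace ℝ (Fin d) → ℝ) (L : NNReal), LipschitzWith L γ ∧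
        ∃ r : ℝ, 0 < r ∧ ∀ z ∈ Metric.ball x r,
          (z ∈ Ω ↔ γ (z - (inner ℝ e z) • e) < inner ℝ e z)

/-! ### Sobolev(-Slobodeckij) spaces `W^{s,p}(Ω)`, `0 < s ≤ 1`, `1 < p < ∞` -/

section Sobolev

variable {d : ℕ}

/-- `g` is a weak (distributional) gradient of `u` in the open set `Ω`. -/
def IsWeakGradient (Ω : Set (EuclideanSpace ℝ (Fin d)))
    (u : EuclideanSpace ℝ (Fin d) → ℝ)
    (g : EuclideanSpace ℝ (Fin d) → EuclideanSpace ℝ (Fin d)) : Prop :=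
  ∀ φ : EuclideanSpace ℝ (Fin d) → ℝ, ContDiff ℝ ∞ φ → HasCompactSupport φ → tsupport φ ⊆ Ω →
    ∀ i : Fin d, ∫ x in Ω, u x * fderiv ℝ φ x (EuclideanSpace.single i 1) =
      - ∫ x in Ω, g x i * φ x

/-- The quotient `(u x - u y) / |x - y| ^ (d / p + s)`, whose `L^p(Ω × Ω)` norm is
the Gagliardo seminorm of `u`. -/
def gagliardoQuotient (s p : ℝ) (u : EuclideanSpace ℝ (Fin d) → ℝ)
    (z : EuclideanSpace ℝ (Fin d) × EuclideanSpace ℝ (Fin d)) : ℝ :=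
  (u z.1 - u z.2) / ‖z.1 - z.2‖ ^ ((d : ℝ) / p + s)

/-- The `W^{s,p}` seminorm with values in `[0, ∞]`. For `s = 1` it is the `L^p` norm of the weak
gradient (the weak gradient is unique up to null sets, and the infimum is `∞` if there
is no weak gradient in `L^p`); for `0 < s < 1` it is the Gagliardo seminorm
`(∫_Ω ∫_Ω |u x - u y|^p / |x - y|^(d + s p) dx dy)^(1/p)`. -/
def sobolevSeminorm (Ω : Set (EuclideanSpace ℝ (Fin d))) (s p : ℝ)
    (u : EuclideanSpace ℝ (Fin d) → ℝ) : ℝ≥0∞ :=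
  if s = 1 then
    ⨅ (g : EuclideanSpace ℝ (Fin d) → EuclideanSpace ℝ (Fin d))
      (_ : MemLp g (ENNReal.ofReal p) (volume.restrict Ω) ∧ IsWeakGradient Ω u g),
      eLpNorm g (ENNReal.ofReal p) (volume.restrict Ω)
  else
    eLpNorm (gagliardoQuotient s p u) (ENNReal.ofReal p)
      ((volume.restrict Ω).prod (volume.restrict Ω))

instance factOneLeOfReal (p : ℝ) [hp : Fact (1 < p)] : Fact (1 ≤ ENNReal.ofReal p) :=
  ⟨by simpa using hp.out.le⟩

theorem IsWeakGradient.congr {Ω : Set (EuclideanSpace ℝ (Fin d))}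
    {u v : EuclideanSpace ℝ (Fin d) → ℝ}
    {g : EuclideanSpace ℝ (Fin d) → EuclideanSpace ℝ (Fin d)}
    (h : IsWeakGradient Ω u g) (huv : u =ᵐ[volume.restrict Ω] v) : IsWeakGradient Ω v g := by
  intro φ h1 h2 h3 i
  rw [← h φ h1 h2 h3 i]
  refine integral_congr_ae ?_
  filter_upwards [huv] with x hx
  rw [hx]

theorem IsWeakGradient.add {p : ℝ} [Fact (1 < p)] {Ω : Set (EuclideanSpace ℝ (Fin d))}
    {u v : EuclideanSpace ℝ (Fin d) → ℝ}
    {g k : EuclideanSpace ℝ (Fin d) → EuclideanSpace ℝ (Fin d)}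
    (hu : MemLp u (ENNReal.ofReal p) (volume.restrict Ω))
    (hv : MemLp v (ENNReal.ofReal p) (volume.restrict Ω))
    (hg : MemLp g (ENNReal.ofReal p) (volume.restrict Ω))
    (hk : MemLp k (ENNReal.ofReal p) (volume.restrict Ω))
    (h : IsWeakGradient Ω u g) (h' : IsWeakGradient Ω v k) :
    IsWeakGradient Ω (u + v) (g + k) := by
  intro φ h1 h2 h3 i
  have key : ∀ {f ψ : EuclideanSpace ℝ (Fin d) → ℝ},
      MemLp f (ENNReal.ofReal p) (volume.restrict Ω) → Continuous ψ → HasCompactSupport ψ →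
      Integrable (fun x => f x * ψ x) (volume.restrict Ω) := by
    intro f ψ hf hψ hc
    have hl : LocallyIntegrable f (volume.restrict Ω) := hf.locallyIntegrable Fact.out
    simpa [mul_comm] using hl.integrable_smul_left_of_hasCompactSupport hψ hc
  have hder : Continuous fun x => fderiv ℝ φ x (EuclideanSpace.single i 1) :=
    (h1.continuous_fderiv (by simp)).clm_apply continuous_const
  have hdc : HasCompactSupport fun x => fderiv ℝ φ x (EuclideanSpace.single i 1) :=
    h2.fderiv_apply (𝕜 := ℝ) _
  have coord : ∀ {f : EuclideanSpace ℝ (Fin d) → EuclideanSpace ℝ (Fin d)},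
      MemLp f (ENNReal.ofReal p) (volume.restrict Ω) →
      MemLp (fun x => f x i) (ENNReal.ofReal p) (volume.restrict Ω) := fun {f} hf =>
    (EuclideanSpace.proj (𝕜 := ℝ) i).comp_memLp' hf
  have e1 : ∀ x, (u + v) x * fderiv ℝ φ x (EuclideanSpace.single i 1) =
      u x * fderiv ℝ φ x (EuclideanSpace.single i 1) +
      v x * fderiv ℝ φ x (EuclideanSpace.single i 1) := fun x => by
    simp [add_mul]
  have e2 : ∀ x, (g + k) x i * φ x = g x i * φ x + k x i * φ x := fun x => by simp [add_mul]
  simp only [e1, e2]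
  rw [integral_add (key hu hder hdc) (key hv hder hdc),
    integral_add (key (coord hg) h1.continuous h2) (key (coord hk) h1.continuous h2),
    h φ h1 h2 h3 i, h' φ h1 h2 h3 i]
  ring

theorem IsWeakGradient.const_smul {Ω : Set (EuclideanSpace ℝ (Fin d))}
    {u : EuclideanSpace ℝ (Fin d) → ℝ}
    {g : EuclideanSpace ℝ (Fin d) → EuclideanSpace ℝ (Fin d)} (c : ℝ)
    (h : IsWeakGradient Ω u g) : IsWeakGradient Ω (c • u) (c • g) := by
  intro φ h1 h2 h3 i
  have e1 : ∀ x, (c • u) x * fderiv ℝ φ x (EuclideanSpace.single i 1) =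
      c * (u x * fderiv ℝ φ x (EuclideanSpace.single i 1)) := fun x => by
    simp [mul_assoc]
  have e2 : ∀ x, (c • g) x i * φ x = c * (g x i * φ x) := fun x => by simp [mul_assoc]
  simp only [e1, e2, integral_const_mul]
  rw [h φ h1 h2 h3 i]
  ring

theorem sobolevSeminorm_congr {Ω : Set (EuclideanSpace ℝ (Fin d))} {s p : ℝ}
    {u v : EuclideanSpace ℝ (Fin d) → ℝ} (huv : u =ᵐ[volume.restrict Ω] v) :
    sobolevSeminorm Ω s p u = sobolevSeminorm Ω s p v := by
  unfold sobolevSeminorm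
  split_ifs with hs
  · have : ∀ g, IsWeakGradient Ω u g ↔ IsWeakGradient Ω v g := fun g =>
      ⟨fun h => h.congr huv, fun h => h.congr huv.symm⟩
    simp only [this]
  · refine eLpNorm_congr_ae ?_
    have h1 := (Measure.quasiMeasurePreserving_fst (μ := volume.restrict Ω)
      (ν := volume.restrict Ω)).ae_eq_comp huv
    have h2 := (Measure.quasiMeasurePreserving_snd (μ := volume.restrict Ω)
      (ν := volume.restrict Ω)).ae_eq_comp huv
    filter_upwards [h1, h2] with z hz1 hz2
    simp only [Function.comp_apply] at hz1 hz2
    simp only [gagliardoQuotient, hz1, hz2]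

theorem sobolevSeminorm_zero {Ω : Set (EuclideanSpace ℝ (Fin d))} {s p : ℝ} :
    sobolevSeminorm Ω s p (0 : EuclideanSpace ℝ (Fin d) → ℝ) = 0 := by
  unfold sobolevSeminorm
  split_ifs with hs
  · refine le_antisymm ?_ bot_le
    have h : MemLp (0 : EuclideanSpace ℝ (Fin d) → EuclideanSpace ℝ (Fin d))
        (ENNReal.ofReal p) (volume.restrict Ω) ∧
        IsWeakGradient Ω 0 (0 : EuclideanSpace ℝ (Fin d) → EuclideanSpace ℝ (Fin d)) :=
      ⟨MemLp.zero, fun φ _ _ _ i => by simp⟩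
    exact (iInf₂_le (0 : EuclideanSpace ℝ (Fin d) → EuclideanSpace ℝ (Fin d)) h).trans
      (by simp)
  · have : gagliardoQuotient s p (0 : EuclideanSpace ℝ (Fin d) → ℝ) = 0 := by
      ext z
      simp [gagliardoQuotient]
    rw [this, eLpNorm_zero]

theorem sobolevSeminorm_add_le {Ω : Set (EuclideanSpace ℝ (Fin d))} {s p : ℝ} [Fact (1 < p)]
    {u v : EuclideanSpace ℝ (Fin d) → ℝ}
    (hu : MemLp u (ENNReal.ofReal p) (volume.restrict Ω))
    (hv : MemLp v (ENNReal.ofReal p) (volume.restrict Ω)) :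
    sobolevSeminorm Ω s p (u + v) ≤ sobolevSeminorm Ω s p u + sobolevSeminorm Ω s p v := by
  unfold sobolevSeminorm
  split_ifs with hs
  · simp only [ENNReal.iInf_add, ENNReal.add_iInf]
    refine le_iInf₂ fun k hk => le_iInf₂ fun g hg => ?_
    refine (iInf₂_le (g + k) ⟨hg.1.add hk.1, hg.2.add hu hv hg.1 hk.1 hk.2⟩).trans ?_
    exact eLpNorm_add_le hg.1.1 hk.1.1 Fact.out
  · have meas : ∀ {w : EuclideanSpace ℝ (Fin d) → ℝ},
        AEStronglyMeasurable w (volume.restrict Ω) →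
        AEStronglyMeasurable (gagliardoQuotient s p w)
          ((volume.restrict Ω).prod (volume.restrict Ω)) := by
      intro w hw
      have hden : Measurable fun z : EuclideanSpace ℝ (Fin d) × EuclideanSpace ℝ (Fin d) =>
          ‖z.1 - z.2‖ ^ ((d : ℝ) / p + s) :=
        ((measurable_fst.sub measurable_snd).norm).pow_const _
      exact ((hw.comp_fst.sub hw.comp_snd).aemeasurable.div
        hden.aemeasurable).aestronglyMeasurable
    have : gagliardoQuotient s p (u + v) = gagliardoQuotient s p u + gagliardoQuotient s p v := by
      ext z
      simp only [gagliardoQuotient, Pi.add_apply]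
      ring
    rw [this]
    exact eLpNorm_add_le (meas hu.1) (meas hv.1) Fact.out

theorem sobolevSeminorm_const_smul_le {Ω : Set (EuclideanSpace ℝ (Fin d))} {s p : ℝ}
    (c : ℝ) (u : EuclideanSpace ℝ (Fin d) → ℝ) :
    sobolevSeminorm Ω s p (c • u) ≤ ‖c‖ₑ * sobolevSeminorm Ω s p u := by
  rcases eq_or_ne c 0 with rfl | hc
  · simp [sobolevSeminorm_zero]
  unfold sobolevSeminorm
  split_ifs with hs
  · rw [ENNReal.mul_iInf_of_ne (by simpa using hc) enorm_ne_top]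
    refine le_iInf fun g => ?_
    rw [ENNReal.mul_iInf_of_ne (by simpa using hc) enorm_ne_top]
    refine le_iInf fun hg => ?_
    refine (iInf₂_le (c • g) ⟨hg.1.const_smul c, hg.2.const_smul c⟩).trans ?_
    exact (eLpNorm_const_smul c g _ _).le
  · have : gagliardoQuotient s p (c • u) = c • gagliardoQuotient s p u := by
      ext z
      simp only [gagliardoQuotient, Pi.smul_apply, smul_eq_mul]
      ring
    rw [this]
    exact (eLpNorm_const_smul c _ _ _).le

/-- The elements of `L^p(Ω)` with finite `W^{s,p}` seminorm, as a linear subspace of `L^p(Ω)`. -/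
def sobolevSubmodule (Ω : Set (EuclideanSpace ℝ (Fin d))) (s p : ℝ) [Fact (1 < p)] :
    Submodule ℝ (Lp ℝ (ENNReal.ofReal p) (volume.restrict Ω)) where
  carrier := {u | sobolevSeminorm Ω s p u < (⊤ : ℝ≥0∞)}
  zero_mem' := by
    have h : sobolevSeminorm Ω s p
        ((0 : Lp ℝ (ENNReal.ofReal p) (volume.restrict Ω)) : EuclideanSpace ℝ (Fin d) → ℝ) = 0 := by
      rw [sobolevSeminorm_congr (Lp.coeFn_zero _ _ _), sobolevSeminorm_zero]
    exact h.trans_lt (by simp)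
  add_mem' := by
    intro u v hu hv
    simp only [mem_ofPred_eq] at *
    rw [sobolevSeminorm_congr (Lp.coeFn_add u v)]
    exact (sobolevSeminorm_add_le (Lp.memLp u) (Lp.memLp v)).trans_lt
      (ENNReal.add_lt_top.2 ⟨hu, hv⟩)
  smul_mem' := by
    intro c u hu
    simp only [mem_ofPred_eq] at *
    rw [sobolevSeminorm_congr (Lp.coeFn_smul c u)]
    exact (sobolevSeminorm_const_smul_le c u).trans_lt (ENNReal.mul_lt_top enorm_lt_top hu)

/-- The Sobolev(-Slobodeckij) space `W^{s,p}(Ω)`. This is a type synonym: it carries the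
`W^{s,p}` norm defined below, not the norm of `L^p(Ω)`. -/
def SobolevSpace (Ω : Set (EuclideanSpace ℝ (Fin d))) (s p : ℝ) [Fact (1 < p)] : Type :=
  ↥(sobolevSubmodule Ω s p)

namespace SobolevSpace

variable {Ω : Set (EuclideanSpace ℝ (Fin d))} {s p : ℝ} [Fact (1 < p)]

instance : AddCommGroup (SobolevSpace Ω s p) :=
  inferInstanceAs (AddCommGroup ↥(sobolevSubmodule Ω s p))

instance : Module ℝ (SobolevSpace Ω s p) :=
  inferInstanceAs (Module ℝ ↥(sobolevSubmodule Ω s p))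

/-- The inclusion `W^{s,p}(Ω) → L^p(Ω)`. -/
def toLp : SobolevSpace Ω s p →ₗ[ℝ] Lp ℝ (ENNReal.ofReal p) (volume.restrict Ω) :=
  (sobolevSubmodule Ω s p).subtype

theorem seminorm_lt_top (u : SobolevSpace Ω s p) : sobolevSeminorm Ω s p (toLp u) < (⊤ : ℝ≥0∞) :=
  u.2

/-- The norm `(‖u‖_{L^p}^p + |u|_{W^{s,p}}^p)^(1/p)`. -/
instance : Norm (SobolevSpace Ω s p) :=
  ⟨fun u => (‖toLp u‖ ^ p + (sobolevSeminorm Ω s p (toLp u)).toReal ^ p) ^ (1 / p)⟩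

theorem norm_def (u : SobolevSpace Ω s p) :
    ‖u‖ = (‖toLp u‖ ^ p + (sobolevSeminorm Ω s p (toLp u)).toReal ^ p) ^ (1 / p) :=
  rfl

theorem seminorm_add_le (u v : SobolevSpace Ω s p) :
    (sobolevSeminorm Ω s p (toLp (u + v))).toReal ≤
      (sobolevSeminorm Ω s p (toLp u)).toReal + (sobolevSeminorm Ω s p (toLp v)).toReal := by
  rw [← ENNReal.toReal_add (seminorm_lt_top u).ne (seminorm_lt_top v).ne]
  refine ENNReal.toReal_mono
    (ENNReal.add_lt_top.2 ⟨seminorm_lt_top u, seminorm_lt_top v⟩).ne ?_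
  rw [map_add, sobolevSeminorm_congr (Lp.coeFn_add (toLp u) (toLp v))]
  exact sobolevSeminorm_add_le (Lp.memLp _) (Lp.memLp _)

theorem seminorm_smul_le (c : ℝ) (u : SobolevSpace Ω s p) :
    (sobolevSeminorm Ω s p (toLp (c • u))).toReal ≤
      |c| * (sobolevSeminorm Ω s p (toLp u)).toReal := by
  have h : sobolevSeminorm Ω s p (toLp (c • u)) ≤ ‖c‖ₑ * sobolevSeminorm Ω s p (toLp u) := by
    rw [map_smul, sobolevSeminorm_congr (Lp.coeFn_smul c (toLp u))]
    exact sobolevSeminorm_const_smul_le c _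
  have h2 := ENNReal.toReal_mono (ENNReal.mul_lt_top enorm_lt_top (seminorm_lt_top u)).ne h
  simpa [ENNReal.toReal_mul] using h2

theorem norm_add_le' (u v : SobolevSpace Ω s p) : ‖u + v‖ ≤ ‖u‖ + ‖v‖ := by
  have hp : 1 < p := Fact.out
  have hp0 : 0 ≤ p := by linarith
  have hip : 0 ≤ 1 / p := by positivity
  have h := Real.Lp_add_le_of_nonneg (Finset.univ : Finset (Fin 2)) hp.le
    (f := ![‖toLp u‖, (sobolevSeminorm Ω s p (toLp u)).toReal])
    (g := ![‖toLp v‖, (sobolevSeminorm Ω s p (toLp v)).toReal])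
    (by intro i _; fin_cases i <;> simp) (by intro i _; fin_cases i <;> simp)
  simp only [Fin.sum_univ_two, Matrix.cons_val_zero, Matrix.cons_val_one] at h
  simp only [norm_def]
  refine le_trans (Real.rpow_le_rpow (by positivity) ?_ hip) h
  refine add_le_add (Real.rpow_le_rpow (by positivity) ?_ hp0)
    (Real.rpow_le_rpow (by positivity) (seminorm_add_le u v) hp0)
  rw [map_add]
  exact norm_add_le _ _

theorem norm_smul_le' (c : ℝ) (u : SobolevSpace Ω s p) : ‖c • u‖ ≤ |c| * ‖u‖ := by
  have hp : 1 < p := Fact.out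
  have hp0 : 0 ≤ p := by linarith
  have hpne : p ≠ 0 := by linarith
  have hip : 0 ≤ 1 / p := by positivity
  simp only [norm_def]
  have hc : |c| = (|c| ^ p) ^ (1 / p) := by
    rw [← Real.rpow_mul (abs_nonneg c), mul_one_div_cancel hpne, Real.rpow_one]
  rw [hc, ← Real.mul_rpow (by positivity) (by positivity)]
  refine Real.rpow_le_rpow (by positivity) ?_ hip
  rw [mul_add, ← Real.mul_rpow (by positivity) (by positivity),
    ← Real.mul_rpow (by positivity) (by positivity)]
  refine add_le_add (Real.rpow_le_rpow (by positivity) ?_ hp0)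
    (Real.rpow_le_rpow (by positivity) (seminorm_smul_le c u) hp0)
  rw [map_smul, norm_smul, Real.norm_eq_abs]

theorem norm_zero' : ‖(0 : SobolevSpace Ω s p)‖ = 0 := by
  refine le_antisymm ?_ (by rw [norm_def]; positivity)
  simpa using norm_smul_le' 0 (0 : SobolevSpace Ω s p)

theorem eq_zero_of_norm (u : SobolevSpace Ω s p) (h : ‖u‖ = 0) : u = 0 := by
  have hp : 1 < p := Fact.out
  rw [norm_def, Real.rpow_eq_zero (by positivity) (by positivity)] at h
  have h1 : ‖toLp u‖ ^ p = 0 := by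
    have ha : 0 ≤ ‖toLp u‖ ^ p := by positivity
    have hb : 0 ≤ (sobolevSeminorm Ω s p (toLp u)).toReal ^ p := by positivity
    linarith
  rw [Real.rpow_eq_zero (norm_nonneg _) (by linarith), norm_eq_zero] at h1
  exact Subtype.ext h1

instance : NormedAddCommGroup (SobolevSpace Ω s p) :=
  AddGroupNorm.toNormedAddCommGroup
    { toFun := fun u => ‖u‖
      map_zero' := norm_zero'
      add_le' := norm_add_le'
      neg' := fun u => by
        refine le_antisymm ?_ ?_
        · simpa using norm_smul_le' (-1) u
        · simpa using norm_smul_le' (-1) (-u)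
      eq_zero_of_map_eq_zero' := eq_zero_of_norm }

instance : NormedSpace ℝ (SobolevSpace Ω s p) where
  norm_smul_le := norm_smul_le'

end SobolevSpace

/-- The set `{q ∈ L^∞(Ω) : -1 ≤ q ≤ 1 a.e.}` as a subset of the dual of `W^{s,p}(Ω)`:
the function `q` is identified with the functional `v ↦ ∫_Ω q v dx`. -/
def unitBoundsInDual (Ω : Set (EuclideanSpace ℝ (Fin d))) (s p : ℝ) [Fact (1 < p)] :
    Set (StrongDual ℝ (SobolevSpace Ω s p)) :=
  {ℓ | ∃ q : Lp ℝ ⊤ (volume.restrict Ω),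
    (∀ᵐ x ∂(volume.restrict Ω), -1 ≤ q x ∧ q x ≤ 1) ∧
      ∀ v : SobolevSpace Ω s p, ℓ v = ∫ x in Ω, q x * SobolevSpace.toLp v x}

end Sobolev

end

/-! Closedness and convexity come from a polar description of the set: a functional `ℓ` is given by
some `q` with values in `[-1, 1]` exactly when `ℓ v ≤ ‖v‖_{L¹}` for all Sobolev `v`
(`mem_unitBoundsInDual_iff`). The nontrivial direction is Hahn–Banach from the image of the Sobolev
space to `L¹`, followed by the representation of functionals on `L¹`. The set is thus an
intersection of closed half-spaces of the dual.

Polyhedricity fails at `w = 1`, tested with evaluation `η` at the Sobolev function `v₀ x = ‖x - x₀‖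
^ 2`, where `x₀ ∈ Ω`. Since `v₀ ≥ 0`, `η` is maximal over the set at `w`, hence normal. A radial
direction is a function `t (q - 1) ≤ 0`; if it annihilates `v₀`, which is positive a.e., it
vanishes. So the radial cone meets the kernel of `η` only in `0`.

The tangent cone, however, contains the negative Dirac measure at `x₀`, which also annihilates `v₀`
because `v₀ x₀ = 0`, but is not zero because it sends the constant `1` to `-1`. It is a limit of
negatives of mollifiers, which are bounded nonpositive functions and hence radial directions.

The analytic core is that the mollifiers converge in the dual norm, and this is where `s p > d`
enters. Averages of `v` at the scales `r` and `r / 2` differ by at most `C r^(s - d/p) ‖v‖`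
(`exists_abs_integral_mollifier_sub_half_le`), so along `r = R / 2 ^ n` the mollifiers form a Cauchy
sequence with geometric rate. The argument stays inside one ball in `Ω`, and the Dirac functional is
obtained as the limit itself, with no appeal to a Sobolev embedding. -/

/-! ### Bounded functionals on `L¹` of a finite measure -/

section DualL1

variable {α : Type*} [MeasurableSpace α] {μ : Measure α} [IsFiniteMeasure μ]

/-- The inclusion `Lᵖ → L¹` for a finite measure. -/
noncomputable def lpToL1 (μ : Measure α) [IsFiniteMeasure μ] (p : ℝ≥0∞) [hp : Fact (1 ≤ p)] :
    Lp ℝ p μ →L[ℝ] Lp ℝ 1 μ :=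
  LinearMap.mkContinuous
    { toFun := fun f => ((Lp.memLp f).mono_exponent hp.out).toLp f
      map_add' := fun f g => by
        rw [← MemLp.toLp_add]
        exact MemLp.toLp_congr _ _ (Lp.coeFn_add f g)
      map_smul' := fun c f => by
        rw [RingHom.id_apply, ← MemLp.toLp_const_smul]
        exact MemLp.toLp_congr _ _ (Lp.coeFn_smul c f) }
    (μ univ ^ (1 / (1 : ℝ≥0∞).toReal - 1 / p.toReal)).toReal fun f => by
      have h := eLpNorm_le_eLpNorm_mul_rpow_measure_univ hp.out (Lp.aestronglyMeasurable f)
      have hexp : 0 ≤ 1 / (1 : ℝ≥0∞).toReal - 1 / p.toReal := by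
        rcases eq_or_ne p ⊤ with rfl | hpt
        · simp
        · have h1 : 1 ≤ p.toReal := by
            simpa using ENNReal.toReal_mono hpt hp.out
          have := (div_le_one (by linarith)).2 h1
          simpa using this
      have hfin : μ univ ^ (1 / (1 : ℝ≥0∞).toReal - 1 / p.toReal) ≠ ⊤ :=
        ENNReal.rpow_ne_top_of_nonneg hexp (measure_ne_top _ _)
      have h2 := ENNReal.toReal_mono (ENNReal.mul_ne_top (Lp.eLpNorm_ne_top f) hfin) h
      rw [ENNReal.toReal_mul, mul_comm] at h2
      change ‖MemLp.toLp f ((Lp.memLp f).mono_exponent hp.out)‖ ≤ _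
      rw [Lp.norm_toLp, Lp.norm_def]
      exact h2

theorem coeFn_lpToL1 {p : ℝ≥0∞} [hp : Fact (1 ≤ p)] (f : Lp ℝ p μ) :
    lpToL1 μ p f =ᵐ[μ] f :=
  MemLp.coeFn_toLp ((Lp.memLp f).mono_exponent hp.out)

theorem norm_lpToL1 {p : ℝ≥0∞} [hp : Fact (1 ≤ p)] (f : Lp ℝ p μ) :
    ‖lpToL1 μ p f‖ = ∫ x, |f x| ∂μ := by
  rw [L1.norm_eq_integral_norm]
  refine integral_congr_ae ?_
  filter_upwards [coeFn_lpToL1 f] with x hx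
  rw [hx, Real.norm_eq_abs]

/-- A linear functional on `L¹` bounded by the norm is the integral against a function with
values in `[-1, 1]`. -/
theorem exists_unitBounds_eq_integral (Λ : Lp ℝ 1 μ →ₗ[ℝ] ℝ) (hΛ : ∀ f, Λ f ≤ ‖f‖) :
    ∃ q : Lp ℝ ⊤ μ, (∀ᵐ x ∂μ, -1 ≤ q x ∧ q x ≤ 1) ∧ ∀ f, Λ f = ∫ x, q x * f x ∂μ := by
  have habs : ∀ f, ‖Λ f‖ ≤ 1 * ‖f‖ := fun f => by
    rw [one_mul, Real.norm_eq_abs, abs_le']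
    refine ⟨hΛ f, ?_⟩
    have := hΛ (-f)
    rwa [map_neg, norm_neg] at this
  let Λc : Lp ℝ 1 μ →L[ℝ] ℝ := Λ.mkContinuous 1 habs
  have : Fact ((1 : ℝ≥0∞) ≤ 2) := ⟨by norm_num⟩
  -- As the measure is finite, `L²` embeds in `L¹`, and the Riesz theorem in the Hilbert space `L²`
  -- already produces the density.
  let r : Lp ℝ 2 μ := (InnerProductSpace.toDual ℝ (Lp ℝ 2 μ)).symm (Λc.comp (lpToL1 μ 2))
  have hr : ∀ f : Lp ℝ 2 μ, Λ (lpToL1 μ 2 f) = ∫ x, r x * f x ∂μ := fun f => by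
    have h1 : inner ℝ r f = Λ (lpToL1 μ 2 f) := InnerProductSpace.toDual_symm_apply
    rw [← h1, L2.inner_def]
    refine integral_congr_ae (Eventually.of_forall fun x => ?_)
    simp [mul_comm]
  have hind : ∀ (c : ℝ) {A : Set α} (hA : MeasurableSet A),
      Λ (indicatorConstLp 1 hA (measure_ne_top μ A) c) = ∫ x in A, r x * c ∂μ := fun c A hA => by
    have h1 : lpToL1 μ 2 (indicatorConstLp 2 hA (measure_ne_top μ A) c) =
        indicatorConstLp 1 hA (measure_ne_top μ A) c := by
      refine Lp.ext ?_
      filter_upwards [coeFn_lpToL1 (indicatorConstLp 2 hA (measure_ne_top μ A) c),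
        indicatorConstLp_coeFn (p := 2) (hs := hA) (hμs := measure_ne_top μ A) (c := c),
        indicatorConstLp_coeFn (p := 1) (hs := hA) (hμs := measure_ne_top μ A) (c := c)]
        with x h1 h2 h3
      rw [h1, h2, h3]
    rw [← h1, hr, ← integral_indicator hA]
    refine integral_congr_ae ?_
    filter_upwards [indicatorConstLp_coeFn (p := 2) (hs := hA) (hμs := measure_ne_top μ A)
      (c := c)] with x h2
    rw [h2]
    by_cases hx : x ∈ A <;> simp [hx]
  have hrint : Integrable r μ := (Lp.memLp r).integrable (by norm_num)
  have hnorm : ∀ (c : ℝ) {A : Set α} (hA : MeasurableSet A),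
      ‖indicatorConstLp 1 hA (measure_ne_top μ A) c‖ = |c| * μ.real A := fun c A hA => by
    rw [norm_indicatorConstLp (by simp) (by simp)]
    simp
  -- Testing with the indicators of `A` and their negatives gives `|∫_A r| ≤ μ A` for all measurable
  -- `A`, hence `|r| ≤ 1` a.e.
  have hub : (r : α → ℝ) ≤ᵐ[μ] fun _ => 1 := by
    refine ae_le_of_forall_setIntegral_le hrint (integrable_const _) fun A hA _ => ?_
    have h1 := hΛ (indicatorConstLp 1 hA (measure_ne_top μ A) 1)
    rw [hind, hnorm] at h1
    simpa using h1
  have hlb : (fun _ => -1) ≤ᵐ[μ] (r : α → ℝ) := by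
    refine ae_le_of_forall_setIntegral_le (integrable_const _) hrint fun A hA _ => ?_
    have h1 := hΛ (indicatorConstLp 1 hA (measure_ne_top μ A) (-1))
    rw [hind, hnorm, integral_mul_const] at h1
    simp at h1 ⊢
    linarith
  have hbd : ∀ᵐ x ∂μ, ‖r x‖ ≤ 1 := by
    filter_upwards [hub, hlb] with x h1 h2
    exact abs_le.2 ⟨h2, h1⟩
  have hrtop : MemLp r ⊤ μ := memLp_top_of_bound (Lp.aestronglyMeasurable r) 1 hbd
  refine ⟨hrtop.toLp r, ?_, fun f => ?_⟩
  · filter_upwards [hrtop.coeFn_toLp, hub, hlb] with x h1 h2 h3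
    rw [h1]
    exact ⟨h3, h2⟩
  have hq : ∀ f : Lp ℝ 1 μ, ∫ x, hrtop.toLp r x * f x ∂μ = ∫ x, r x * f x ∂μ := fun f => by
    refine integral_congr_ae ?_
    filter_upwards [hrtop.coeFn_toLp] with x h1
    rw [h1]
  rw [hq f]
  have hint : ∀ f : Lp ℝ 1 μ, Integrable (fun x => r x * f x) μ := fun f =>
    (L1.integrable_coeFn f).bdd_mul (Lp.aestronglyMeasurable r) hbd
  let I : Lp ℝ 1 μ →ₗ[ℝ] ℝ :=
    { toFun := fun f => ∫ x, r x * f x ∂μ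
      map_add' := fun f g => by
        rw [← integral_add (hint f) (hint g)]
        refine integral_congr_ae ?_
        filter_upwards [Lp.coeFn_add f g] with x hx
        rw [hx, Pi.add_apply, mul_add]
      map_smul' := fun c f => by
        rw [RingHom.id_apply, smul_eq_mul, ← integral_const_mul]
        refine integral_congr_ae ?_
        filter_upwards [Lp.coeFn_smul c f] with x hx
        rw [hx, Pi.smul_apply, smul_eq_mul]
        ring }
  have hIb : ∀ f, ‖I f‖ ≤ 1 * ‖f‖ := fun f => by
    rw [one_mul, L1.norm_eq_integral_norm]
    refine norm_integral_le_of_norm_le (L1.integrable_coeFn f).norm ?_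
    filter_upwards [hbd] with x hx
    rw [norm_mul]
    exact mul_le_of_le_one_left (norm_nonneg _) hx
  let Ic : Lp ℝ 1 μ →L[ℝ] ℝ := I.mkContinuous 1 hIb
  change Λc f = Ic f
  -- Both functionals are continuous on `L¹` and agree on indicators, so they agree on the dense set
  -- of simple functions and then everywhere.
  refine Lp.induction (by simp) (motive := fun f => Λc f = Ic f) ?_ ?_ ?_ f
  · intro c A hA hμA
    rw [Lp.simpleFunc.coe_indicatorConst]
    change Λ _ = I _
    rw [hind]
    change _ = ∫ x, r x * _ ∂μ
    rw [← integral_indicator hA]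
    refine integral_congr_ae ?_
    filter_upwards [indicatorConstLp_coeFn (p := 1) (hs := hA) (hμs := measure_ne_top μ A)
      (c := c)] with x h2
    rw [h2]
    by_cases hx : x ∈ A <;> simp [hx]
  · intro f g hf hg _ h1 h2
    rw [map_add, map_add, h1, h2]
  · exact isClosed_eq Λc.continuous Ic.continuous

end DualL1

/-! ### The order interval as a polar set -/

namespace SobolevSpace

variable {d : ℕ} {Ω : Set (EuclideanSpace ℝ (Fin d))} {s p : ℝ} [hp : Fact (1 < p)]

theorem norm_toLp_le (u : SobolevSpace Ω s p) : ‖toLp u‖ ≤ ‖u‖ := by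
  have hp0 : 0 < p := by linarith [hp.out]
  rw [norm_def]
  calc ‖toLp u‖ = (‖toLp u‖ ^ p) ^ (1 / p) := by
        rw [← Real.rpow_mul (norm_nonneg _), mul_one_div_cancel hp0.ne', Real.rpow_one]
    _ ≤ _ := Real.rpow_le_rpow (by positivity) (le_add_of_nonneg_right (by positivity))
        (by positivity)

theorem toReal_seminorm_le (u : SobolevSpace Ω s p) :
    (sobolevSeminorm Ω s p (toLp u)).toReal ≤ ‖u‖ := by
  have hp0 : 0 < p := by linarith [hp.out]
  rw [norm_def]
  calc (sobolevSeminorm Ω s p (toLp u)).toReal =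
        ((sobolevSeminorm Ω s p (toLp u)).toReal ^ p) ^ (1 / p) := by
        rw [← Real.rpow_mul ENNReal.toReal_nonneg, mul_one_div_cancel hp0.ne', Real.rpow_one]
    _ ≤ _ := Real.rpow_le_rpow (by positivity) (le_add_of_nonneg_left (by positivity))
        (by positivity)

/-- The element of the Sobolev space given by a function. -/
noncomputable def ofFun (f : EuclideanSpace ℝ (Fin d) → ℝ)
    (hf : MemLp f (ENNReal.ofReal p) (volume.restrict Ω))
    (h : sobolevSeminorm Ω s p f < ⊤) : SobolevSpace Ω s p :=
  ⟨hf.toLp f, by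
    change sobolevSeminorm Ω s p _ < ⊤
    rwa [sobolevSeminorm_congr hf.coeFn_toLp]⟩

theorem toLp_ofFun {f : EuclideanSpace ℝ (Fin d) → ℝ}
    (hf : MemLp f (ENNReal.ofReal p) (volume.restrict Ω)) (h : sobolevSeminorm Ω s p f < ⊤) :
    toLp (ofFun f hf h) =ᵐ[volume.restrict Ω] f :=
  hf.coeFn_toLp

variable [IsFiniteMeasure (volume.restrict Ω)]

/-- The inclusion of the Sobolev space in `L¹`. -/
noncomputable def toL1 : SobolevSpace Ω s p →L[ℝ] Lp ℝ 1 (volume.restrict Ω) :=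
  (lpToL1 (volume.restrict Ω) (ENNReal.ofReal p)).comp
    (LinearMap.mkContinuous toLp 1 fun u => by simpa using norm_toLp_le u)

theorem coeFn_toL1 (u : SobolevSpace Ω s p) : toL1 u =ᵐ[volume.restrict Ω] toLp u :=
  coeFn_lpToL1 (toLp u)

theorem norm_toL1 (u : SobolevSpace Ω s p) : ‖toL1 u‖ = ∫ x in Ω, |toLp u x| :=
  norm_lpToL1 (toLp u)

theorem toL1_injective :
    Function.Injective (toL1 : SobolevSpace Ω s p →L[ℝ] Lp ℝ 1 (volume.restrict Ω)) := by
  intro u v h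
  refine Subtype.ext (Lp.ext ?_)
  have h2 : (toL1 u : EuclideanSpace ℝ (Fin d) → ℝ) =ᵐ[volume.restrict Ω] toL1 v := by rw [h]
  exact (coeFn_toL1 u).symm.trans (h2.trans (coeFn_toL1 v))

theorem integrable_toLp (u : SobolevSpace Ω s p) : Integrable (toLp u) (volume.restrict Ω) :=
  (L1.integrable_coeFn (toL1 u)).congr (coeFn_toL1 u)

/-- Integration against an essentially bounded function, as a functional on the Sobolev space. -/
noncomputable def integralDual (q : EuclideanSpace ℝ (Fin d) → ℝ)
    (hq : MemLp q ⊤ (volume.restrict Ω)) : StrongDual ℝ (SobolevSpace Ω s p) :=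
  ((ContinuousLinearMap.mul ℝ ℝ).lpPairing (volume.restrict Ω) ⊤ 1 (hq.toLp q)).comp toL1

theorem integralDual_apply {q : EuclideanSpace ℝ (Fin d) → ℝ}
    (hq : MemLp q ⊤ (volume.restrict Ω)) (v : SobolevSpace Ω s p) :
    integralDual q hq v = ∫ x in Ω, q x * toLp v x := by
  change (ContinuousLinearMap.mul ℝ ℝ).lpPairing (volume.restrict Ω) ⊤ 1 (hq.toLp q) (toL1 v) = _
  rw [ContinuousLinearMap.lpPairing_eq_integral]
  refine integral_congr_ae ?_
  filter_upwards [hq.coeFn_toLp, coeFn_toL1 v] with x h1 h2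
  rw [h1, h2, ContinuousLinearMap.mul_apply']

theorem integralDual_mem_unitBoundsInDual {q : EuclideanSpace ℝ (Fin d) → ℝ}
    (hq : MemLp q ⊤ (volume.restrict Ω))
    (hb : ∀ᵐ x ∂(volume.restrict Ω), -1 ≤ q x ∧ q x ≤ 1) :
    integralDual q hq ∈ unitBoundsInDual Ω s p := by
  refine ⟨hq.toLp q, ?_, fun v => ?_⟩
  · filter_upwards [hq.coeFn_toLp, hb] with x h1 h2
    rwa [h1]
  · rw [integralDual_apply]
    refine integral_congr_ae ?_
    filter_upwards [hq.coeFn_toLp] with x h1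
    rw [h1]

/-- For the converse direction, `ℓ` is viewed as a functional on the image of the Sobolev space in
`L¹`, where it is dominated by the `L¹` norm. Hahn–Banach extends it with the same bound, and its
density on `L¹` is the required `q`. The right-hand side consists of pointwise inequalities in `ℓ`,
which survive limits and convex combinations. -/
theorem mem_unitBoundsInDual_iff (ℓ : StrongDual ℝ (SobolevSpace Ω s p)) :
    ℓ ∈ unitBoundsInDual Ω s p ↔ ∀ v, ℓ v ≤ ‖toL1 v‖ := by
  constructor
  · rintro ⟨q, hq, h⟩ v
    rw [h, norm_toL1]
    refine (le_abs_self _).trans ?_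
    rw [← Real.norm_eq_abs]
    refine norm_integral_le_of_norm_le (integrable_toLp v).abs ?_
    filter_upwards [hq] with x hx
    rw [norm_mul, Real.norm_eq_abs, Real.norm_eq_abs]
    exact mul_le_of_le_one_left (abs_nonneg _) (abs_le.2 hx)
  · intro h
    let i : SobolevSpace Ω s p →ₗ[ℝ] Lp ℝ 1 (volume.restrict Ω) := toL1.toLinearMap
    let e := LinearEquiv.ofInjective i toL1_injective
    obtain ⟨g, hg, hgN⟩ := exists_extension_of_le_sublinear
      (⟨LinearMap.range i, ℓ.toLinearMap.comp e.symm.toLinearMap⟩ :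
        Lp ℝ 1 (volume.restrict Ω) →ₗ.[ℝ] ℝ) (fun f => ‖f‖)
      (fun c hc x => by rw [norm_smul, Real.norm_of_nonneg hc.le])
      norm_add_le (fun x => by
        obtain ⟨u, hu⟩ := e.surjective x
        change ℓ (e.symm x) ≤ _
        rw [← hu, e.symm_apply_apply]
        exact h u)
    obtain ⟨q, hq, hqi⟩ := exists_unitBounds_eq_integral g hgN
    refine ⟨q, hq, fun v => ?_⟩
    have h1 : g (toL1 v) = ℓ v := by
      refine (hg (e v)).trans ?_
      change ℓ (e.symm (e v)) = _
      rw [e.symm_apply_apply]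
    rw [← h1, hqi]
    refine integral_congr_ae ?_
    filter_upwards [coeFn_toL1 v] with x h2
    rw [h2]

theorem unitBoundsInDual_eq :
    unitBoundsInDual Ω s p = ⋂ v : SobolevSpace Ω s p, {ℓ | ℓ v ≤ ‖toL1 v‖} := by
  ext ℓ
  rw [mem_unitBoundsInDual_iff, mem_iInter]
  rfl

theorem isClosed_unitBoundsInDual : IsClosed (unitBoundsInDual Ω s p) := by
  rw [unitBoundsInDual_eq]
  exact isClosed_iInter fun v =>
    isClosed_le (ContinuousLinearMap.apply ℝ ℝ v).continuous continuous_const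

theorem convex_unitBoundsInDual : Convex ℝ (unitBoundsInDual Ω s p) := by
  rw [unitBoundsInDual_eq]
  exact convex_iInter fun v =>
    convex_halfSpace_le (ContinuousLinearMap.apply ℝ ℝ v).isLinear _

end SobolevSpace

/-! ### Smooth functions belong to the Sobolev space -/

section Smooth

variable {d : ℕ} {Ω : Set (EuclideanSpace ℝ (Fin d))}

theorem memLp_of_continuous_of_isBounded {F : Type*} [NormedAddCommGroup F] (hΩ : IsOpen Ω)
    (hb : Bornology.IsBounded Ω) {f : EuclideanSpace ℝ (Fin d) → F} (hf : Continuous f)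
    (q : ℝ≥0∞) : MemLp f q (volume.restrict Ω) := by
  have : IsFiniteMeasure (volume.restrict Ω) :=
    isFiniteMeasure_restrict.2 hb.measure_lt_top.ne
  obtain ⟨R, hR⟩ := hb.subset_closedBall 0
  obtain ⟨C, hC⟩ := (isCompact_closedBall (0 : EuclideanSpace ℝ (Fin d)) R).exists_bound_of_continuousOn
    hf.continuousOn
  refine MemLp.of_bound hf.aestronglyMeasurable C ?_
  filter_upwards [ae_restrict_mem hΩ.measurableSet] with x hx
  exact hC x (hR hx)

/-- The vector of the partial derivatives. -/
noncomputable def partialDerivs (f : EuclideanSpace ℝ (Fin d) → ℝ)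
    (x : EuclideanSpace ℝ (Fin d)) : EuclideanSpace ℝ (Fin d) :=
  WithLp.toLp 2 fun i => fderiv ℝ f x (EuclideanSpace.single i 1)

theorem continuous_partialDerivs {f : EuclideanSpace ℝ (Fin d) → ℝ} (hf : ContDiff ℝ 1 f) :
    Continuous (partialDerivs f) := by
  refine (PiLp.continuous_toLp 2 _).comp (continuous_pi fun i => ?_)
  exact (hf.continuous_fderiv one_ne_zero).clm_apply continuous_const

/-- The test function and its derivative vanish outside `Ω`, so the integrals extend to the whole
space, where integration by parts has no boundary terms. -/
theorem isWeakGradient_partialDerivs {f : EuclideanSpace ℝ (Fin d) → ℝ} (hf : ContDiff ℝ 1 f) :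
    IsWeakGradient Ω f (partialDerivs f) := by
  intro φ hφ hc hs i
  have h0 : ∀ x ∉ Ω, φ x = 0 := fun x hx => image_eq_zero_of_notMem_tsupport fun h => hx (hs h)
  have h1 : ∀ x ∉ Ω, fderiv ℝ φ x = 0 := fun x hx =>
    image_eq_zero_of_notMem_tsupport fun h => hx (hs (tsupport_fderiv_subset ℝ h))
  rw [setIntegral_eq_integral_of_forall_compl_eq_zero fun x hx => by simp [h1 x hx],
    setIntegral_eq_integral_of_forall_compl_eq_zero fun x hx => by simp [h0 x hx]]
  have hdf : Continuous fun x => fderiv ℝ f x (EuclideanSpace.single i 1) :=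
    (hf.continuous_fderiv one_ne_zero).clm_apply continuous_const
  have hdφ : Continuous fun x => fderiv ℝ φ x (EuclideanSpace.single i 1) :=
    (hφ.continuous_fderiv (by simp)).clm_apply continuous_const
  have hcφ : HasCompactSupport fun x => fderiv ℝ φ x (EuclideanSpace.single i 1) :=
    hc.fderiv_apply (𝕜 := ℝ) _
  exact integral_mul_fderiv_eq_neg_fderiv_mul_of_integrable
    ((hdf.mul hφ.continuous).integrable_of_hasCompactSupport hc.mul_left)
    ((hf.continuous.mul hdφ).integrable_of_hasCompactSupport hcφ.mul_left)
    ((hf.continuous.mul hφ.continuous).integrable_of_hasCompactSupport hc.mul_left)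
    (fun x _ => (hf.differentiable one_ne_zero) x) (fun x _ => (hφ.differentiable (by simp)) x)

/-- A `C¹` function is Lipschitz on bounded sets, so the `p`-th power of the quotient is at most a
constant times `‖x - y‖^(p (1 - s) - d)`. For `s < 1` this kernel is locally integrable, and
translation invariance bounds the inner integral uniformly in `x`. -/
theorem lintegral_gagliardoQuotient_lt_top (hd : 0 < d) (hΩ : IsOpen Ω)
    (hb : Bornology.IsBounded Ω) {s p : ℝ} (hp : 0 < p) (hs : s < 1)
    {f : EuclideanSpace ℝ (Fin d) → ℝ} (hf : ContDiff ℝ 1 f) :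
    ∫⁻ z, ‖gagliardoQuotient s p f z‖ₑ ^ p ∂((volume.restrict Ω).prod (volume.restrict Ω)) < ⊤ := by
  -- The mean value inequality is applied on a ball around `Ω`, since segments between points of `Ω`
  -- may leave `Ω`.
  obtain ⟨R, hR⟩ := hb.subset_ball 0
  obtain ⟨L, hL⟩ := (isCompact_closedBall (0 : EuclideanSpace ℝ (Fin d)) R).exists_bound_of_continuousOn
    (hf.continuous_fderiv one_ne_zero).continuousOn
  have hlip : ∀ x ∈ Ω, ∀ y ∈ Ω, |f x - f y| ≤ |L| * ‖x - y‖ := fun x hx y hy => by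
    rw [← Real.norm_eq_abs]
    exact (convex_ball (0 : EuclideanSpace ℝ (Fin d)) R).norm_image_sub_le_of_norm_fderiv_le
      (fun z _ => (hf.differentiable one_ne_zero) z)
      (fun z hz => (hL z (Metric.ball_subset_closedBall hz)).trans (le_abs_self L)) (hR hy) (hR hx)
  set α : ℝ := d - p * (1 - s) with hα
  let H : EuclideanSpace ℝ (Fin d) → ℝ := fun z => |L| ^ p * ‖z‖ ^ (-α)
  have hHm : Measurable H := (measurable_norm.pow_const _).const_mul _
  have hHi : IntegrableOn H (Metric.ball 0 (2 * R)) := by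
    refine integrableOn_ball_of_norm_le_rpow (μ := volume) (α := α) (C := |L| ^ p) ?_ ?_ ?_
      hHm.aestronglyMeasurable
    · rw [finrank_euclideanSpace, Fintype.card_fin]
      exact hd
    · simp only [finrank_euclideanSpace, Fintype.card_fin, hα]
      have := mul_pos hp (sub_pos.2 hs)
      linarith
    · refine Eventually.of_forall fun z => ?_
      rw [Real.norm_of_nonneg (by positivity)]
  let G : EuclideanSpace ℝ (Fin d) → ℝ≥0∞ :=
    (Metric.ball 0 (2 * R)).indicator fun z => ENNReal.ofReal (H z)
  have hGm : Measurable G := hHm.ennreal_ofReal.indicator Metric.isOpen_ball.measurableSet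
  have hGi : ∫⁻ z, G z < ⊤ := by
    rw [lintegral_indicator Metric.isOpen_ball.measurableSet]
    refine lt_of_eq_of_lt (lintegral_congr fun z => ?_) hHi.2
    rw [← Real.enorm_of_nonneg (by positivity)]
  have hle : ∀ᵐ z ∂((volume.restrict Ω).prod (volume.restrict Ω)),
      ‖gagliardoQuotient s p f z‖ₑ ^ p ≤ G (z.1 - z.2) := by
    rw [Measure.prod_restrict]
    filter_upwards [ae_restrict_mem (hΩ.measurableSet.prod hΩ.measurableSet)] with z hz
    have hmem : z.1 - z.2 ∈ Metric.ball (0 : EuclideanSpace ℝ (Fin d)) (2 * R) := by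
      have h1 := mem_ball_zero_iff.1 (hR hz.1)
      have h2 := mem_ball_zero_iff.1 (hR hz.2)
      rw [mem_ball_zero_iff]
      linarith [norm_sub_le z.1 z.2]
    simp only [G, indicator_of_mem hmem]
    rw [← ofReal_norm, ENNReal.ofReal_rpow_of_nonneg (norm_nonneg _) hp.le]
    refine ENNReal.ofReal_le_ofReal ?_
    rcases eq_or_ne z.1 z.2 with h | h
    · simp only [gagliardoQuotient, h, sub_self, zero_div, norm_zero, Real.zero_rpow hp.ne']
      positivity
    · have hr : 0 < ‖z.1 - z.2‖ := norm_pos_iff.2 (sub_ne_zero.2 h)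
      rw [gagliardoQuotient, norm_div, Real.norm_of_nonneg (Real.rpow_nonneg hr.le _),
        Real.div_rpow (norm_nonneg _) (by positivity), ← Real.rpow_mul hr.le]
      refine (div_le_div_of_nonneg_right (Real.rpow_le_rpow (norm_nonneg _)
        (hlip _ hz.1 _ hz.2) hp.le) (by positivity)).trans_eq ?_
      rw [Real.mul_rpow (abs_nonneg _) hr.le, mul_div_assoc, ← Real.rpow_sub hr]
      congr 2
      rw [hα]
      field_simp
      ring
  refine (lintegral_mono_ae hle).trans_lt ?_
  rw [lintegral_prod _ (by fun_prop)]
  calc ∫⁻ x in Ω, ∫⁻ y in Ω, G (x - y) ≤ ∫⁻ _ in Ω, ∫⁻ z, G z := by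
        refine lintegral_mono fun x => (setLIntegral_le_lintegral _ _).trans_eq ?_
        exact lintegral_sub_left_eq_self G x
    _ < ⊤ := by
        rw [lintegral_const, Measure.restrict_apply_univ]
        exact ENNReal.mul_lt_top hGi hb.measure_lt_top

theorem sobolevSeminorm_lt_top_of_contDiff (hd : 0 < d) (hΩ : IsOpen Ω)
    (hb : Bornology.IsBounded Ω) {s p : ℝ} (hp : 0 < p) (hs : s ≤ 1)
    {f : EuclideanSpace ℝ (Fin d) → ℝ} (hf : ContDiff ℝ 1 f) :
    sobolevSeminorm Ω s p f < ⊤ := by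
  unfold sobolevSeminorm
  split_ifs with h
  · have hm := memLp_of_continuous_of_isBounded hΩ hb (continuous_partialDerivs hf)
      (ENNReal.ofReal p)
    exact (iInf₂_le (partialDerivs f) ⟨hm, isWeakGradient_partialDerivs hf⟩).trans_lt hm.2
  · rw [eLpNorm_lt_top_iff_lintegral_rpow_enorm_lt_top (by simpa using hp) (by simp),
      ENNReal.toReal_ofReal hp.le]
    exact lintegral_gagliardoQuotient_lt_top hd hΩ hb hp (lt_of_le_of_ne hs h) hf

end Smooth

/-! ### Differences of averages at two scales -/

section Averages

/-- Hölder's inequality against the constant `1`. On small balls the power of the total mass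
supplies part of the decay in the radius. -/
theorem integral_norm_le_eLpNorm_mul {α F : Type*} [MeasurableSpace α] [NormedAddCommGroup F]
    {ν : Measure α} [IsFiniteMeasure ν] {p : ℝ} (hp : 1 < p) {f : α → F}
    (hf : MemLp f (ENNReal.ofReal p) ν) :
    ∫ x, ‖f x‖ ∂ν ≤ (eLpNorm f (ENNReal.ofReal p) ν).toReal * ν.real univ ^ (1 - 1 / p) := by
  have hp1 : 1 ≤ ENNReal.ofReal p := by simpa using hp.le
  have h := eLpNorm_le_eLpNorm_mul_rpow_measure_univ hp1 hf.1
  have hexp : 0 ≤ 1 - 1 / p := by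
    rw [sub_nonneg, div_le_one (by linarith)]
    exact hp.le
  rw [ENNReal.toReal_one, ENNReal.toReal_ofReal (by linarith), div_one] at h
  have h2 := ENNReal.toReal_mono (ENNReal.mul_ne_top hf.2.ne
    (ENNReal.rpow_ne_top_of_nonneg hexp (measure_ne_top _ _))) h
  rw [ENNReal.toReal_mul, ← ENNReal.toReal_rpow] at h2
  refine le_trans (le_of_eq ?_) h2
  rw [eLpNorm_one_eq_lintegral_enorm, integral_norm_eq_lintegral_enorm hf.1]

variable {d : ℕ} {Ω : Set (EuclideanSpace ℝ (Fin d))}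

theorem aestronglyMeasurable_gagliardoQuotient {s p : ℝ} {u : EuclideanSpace ℝ (Fin d) → ℝ}
    (hu : AEStronglyMeasurable u (volume.restrict Ω)) :
    AEStronglyMeasurable (gagliardoQuotient s p u)
      ((volume.restrict Ω).prod (volume.restrict Ω)) := by
  have hden : Measurable fun z : EuclideanSpace ℝ (Fin d) × EuclideanSpace ℝ (Fin d) =>
      ‖z.1 - z.2‖ ^ ((d : ℝ) / p + s) :=
    ((measurable_fst.sub measurable_snd).norm).pow_const _
  exact ((hu.comp_fst.sub hu.comp_snd).aemeasurable.div hden.aemeasurable).aestronglyMeasurable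

/-- The difference of two weighted averages over a small set is controlled by the
Gagliardo seminorm. -/
theorem abs_integral_sub_integral_le_gagliardo {s p : ℝ} (hp : 1 < p) (hs : 0 < s)
    {S : Set (EuclideanSpace ℝ (Fin d))} (hSm : MeasurableSet S) (hS : S ⊆ Ω)
    (hSfin : volume S ≠ ⊤) {δ : ℝ} (hδ : ∀ x ∈ S, ∀ y ∈ S, ‖x - y‖ ≤ δ) (hδ0 : 0 ≤ δ)
    {u k l : EuclideanSpace ℝ (Fin d) → ℝ} (hu : Integrable u (volume.restrict Ω))
    (hk : Measurable k) (hl : Measurable l) {A : ℝ} (hkA : ∀ x, |k x| ≤ A) (hlA : ∀ x, |l x| ≤ A)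
    (hkS : ∀ x ∉ S, k x = 0) (hlS : ∀ x ∉ S, l x = 0) (hk1 : ∫ x, k x = 1) (hl1 : ∫ x, l x = 1)
    (hQ : eLpNorm (gagliardoQuotient s p u) (ENNReal.ofReal p)
      ((volume.restrict Ω).prod (volume.restrict Ω)) < ⊤) :
    |(∫ x in Ω, k x * u x) - ∫ x in Ω, l x * u x| ≤
      A ^ 2 * δ ^ ((d : ℝ) / p + s) * ((eLpNorm (gagliardoQuotient s p u) (ENNReal.ofReal p)
      ((volume.restrict Ω).prod (volume.restrict Ω))).toReal *
        ((volume.real S) ^ 2) ^ (1 - 1 / p)) := by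
  have : IsFiniteMeasure (volume.restrict S) := isFiniteMeasure_restrict.2 hSfin
  set ν := (volume.restrict S).prod (volume.restrict S) with hν
  have hA : 0 ≤ A := (abs_nonneg _).trans (hkA 0)
  have hθ : 0 ≤ (d : ℝ) / p + s := by positivity
  have hred : ∀ m : EuclideanSpace ℝ (Fin d) → ℝ, (∀ x ∉ S, m x = 0) →
      ∫ x in Ω, m x * u x = ∫ x in S, m x * u x := fun m hm =>
    (setIntegral_eq_integral_of_forall_compl_eq_zero fun x hx => by
      simp [hm x fun h => hx (hS h)]).trans
      (setIntegral_eq_integral_of_forall_compl_eq_zero fun x hx => by simp [hm x hx]).symm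
  have hred1 : ∀ m : EuclideanSpace ℝ (Fin d) → ℝ, (∀ x ∉ S, m x = 0) →
      ∫ x in S, m x = ∫ x, m x := fun m hm => setIntegral_eq_integral_of_forall_compl_eq_zero hm
  have huS : Integrable u (volume.restrict S) := hu.mono_measure (Measure.restrict_mono hS le_rfl)
  have hint : ∀ m : EuclideanSpace ℝ (Fin d) → ℝ, Measurable m → (∀ x, |m x| ≤ A) →
      Integrable m (volume.restrict S) ∧ Integrable (fun x => m x * u x) (volume.restrict S) :=
    fun m hm hmA => ⟨Integrable.of_bound hm.aestronglyMeasurable A (Eventually.of_forall hmA),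
      huS.bdd_mul hm.aestronglyMeasurable (Eventually.of_forall hmA)⟩
  obtain ⟨hki, hkui⟩ := hint k hk hkA
  obtain ⟨hli, hlui⟩ := hint l hl hlA
  -- Because both kernels have integral one, the difference of the averages is a double integral of
  -- `u x - u y`, which can be compared with the Gagliardo quotient.
  have heq : (∫ x in Ω, k x * u x) - ∫ x in Ω, l x * u x =
      ∫ z, k z.1 * l z.2 * (u z.1 - u z.2) ∂ν := by
    have e : ∀ z : EuclideanSpace ℝ (Fin d) × EuclideanSpace ℝ (Fin d),
        k z.1 * l z.2 * (u z.1 - u z.2) = (k z.1 * u z.1) * l z.2 - k z.1 * (l z.2 * u z.2) :=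
      fun z => by ring
    simp only [e]
    rw [integral_sub (hkui.mul_prod hli) (hki.mul_prod hlui), integral_prod_mul
      (fun x => k x * u x) l, integral_prod_mul k fun x => l x * u x, hred k hkS, hred l hlS,
      hred1 k hkS, hred1 l hlS, hk1, hl1, mul_one, one_mul]
  have hνle : ν ≤ (volume.restrict Ω).prod (volume.restrict Ω) := by
    rw [hν, Measure.prod_restrict, Measure.prod_restrict]
    exact Measure.restrict_mono (prod_mono hS hS) le_rfl
  have hmem : MemLp (gagliardoQuotient s p u) (ENNReal.ofReal p) ν :=
    MemLp.mono_measure hνle ⟨aestronglyMeasurable_gagliardoQuotient hu.1, hQ⟩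
  have hp1 : 1 ≤ ENNReal.ofReal p := by simpa using hp.le
  rw [heq, ← Real.norm_eq_abs]
  have hbound : ∀ᵐ z ∂ν, ‖k z.1 * l z.2 * (u z.1 - u z.2)‖ ≤
      A ^ 2 * δ ^ ((d : ℝ) / p + s) * ‖gagliardoQuotient s p u z‖ := by
    rw [hν, Measure.prod_restrict]
    filter_upwards [ae_restrict_mem (hSm.prod hSm)] with z hz
    -- The denominator of the quotient is at most `δ ^ (d / p + s)` on `S × S`; on the diagonal the
    -- left-hand side is zero.
    have h1 : |u z.1 - u z.2| ≤ δ ^ ((d : ℝ) / p + s) * ‖gagliardoQuotient s p u z‖ := by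
      rcases eq_or_ne z.1 z.2 with h | h
      · rw [h, sub_self, abs_zero]
        positivity
      · have hr : 0 < ‖z.1 - z.2‖ := norm_pos_iff.2 (sub_ne_zero.2 h)
        rw [gagliardoQuotient, norm_div, Real.norm_of_nonneg (Real.rpow_nonneg hr.le _),
          Real.norm_eq_abs, ← mul_div_assoc, le_div_iff₀ (by positivity), mul_comm]
        exact mul_le_mul_of_nonneg_right (Real.rpow_le_rpow hr.le (hδ _ hz.1 _ hz.2) hθ)
          (abs_nonneg _)
    rw [norm_mul, norm_mul, Real.norm_eq_abs, Real.norm_eq_abs, Real.norm_eq_abs, mul_assoc (A ^ 2),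
      sq]
    exact mul_le_mul (mul_le_mul (hkA _) (hlA _) (abs_nonneg _) hA) h1 (abs_nonneg _)
      (mul_nonneg hA hA)
  refine (norm_integral_le_of_norm_le ((hmem.integrable hp1).norm.const_mul _) hbound).trans ?_
  rw [integral_const_mul]
  refine mul_le_mul_of_nonneg_left ?_ (by positivity)
  refine (integral_norm_le_eLpNorm_mul hp hmem).trans ?_
  have hνu : ν.real univ = volume.real S ^ 2 := by
    rw [hν, ← univ_prod_univ, measureReal_prod_prod, sq]
    simp
  rw [hνu]
  refine mul_le_mul_of_nonneg_right ?_ (by positivity)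
  exact ENNReal.toReal_mono hQ.ne (eLpNorm_mono_measure _ hνle)

end Averages

/-! ### Mollifiers and their dependence on the scale -/

section Mollifier

variable {d : ℕ}

/-- A smooth non-negative function with integral one, supported in the closed unit ball. -/
noncomputable def unitBump (d : ℕ) : EuclideanSpace ℝ (Fin d) → ℝ :=
  (⟨1 / 2, 1, by norm_num, by norm_num⟩ : ContDiffBump (0 : EuclideanSpace ℝ (Fin d))).normed volume

theorem unitBump_nonneg (z : EuclideanSpace ℝ (Fin d)) : 0 ≤ unitBump d z :=
  ContDiffBump.nonneg_normed _ _

theorem contDiff_unitBump : ContDiff ℝ ∞ (unitBump d) :=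
  ContDiffBump.contDiff_normed _

theorem tsupport_unitBump : tsupport (unitBump d) = Metric.closedBall 0 1 :=
  ContDiffBump.tsupport_normed_eq _

theorem hasCompactSupport_unitBump : HasCompactSupport (unitBump d) :=
  ContDiffBump.hasCompactSupport_normed _

theorem integral_unitBump : ∫ z, unitBump d z = 1 :=
  ContDiffBump.integral_normed _

theorem unitBump_eq_zero {z : EuclideanSpace ℝ (Fin d)} (hz : 1 < ‖z‖) : unitBump d z = 0 := by
  refine image_eq_zero_of_notMem_tsupport ?_
  rw [tsupport_unitBump, mem_closedBall_zero_iff]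
  exact not_le.2 hz

theorem exists_unitBump_le (d : ℕ) : ∃ B : ℝ, 0 < B ∧ ∀ z, |unitBump d z| ≤ B := by
  obtain ⟨C, hC⟩ := contDiff_unitBump.continuous.bounded_above_of_compact_support
    (hasCompactSupport_unitBump (d := d))
  -- The maximum with `1` makes the bound strictly positive, so that it can later serve as a
  -- divisor.
  exact ⟨max C 1, by positivity, fun z => (hC z).trans (le_max_left _ _)⟩

/-- The bump function at scale `t` around `x₀`, with integral one. -/
noncomputable def mollifier (x₀ : EuclideanSpace ℝ (Fin d)) (t : ℝ)
    (x : EuclideanSpace ℝ (Fin d)) : ℝ :=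
  (t ^ d)⁻¹ * unitBump d (t⁻¹ • (x - x₀))

variable {x₀ : EuclideanSpace ℝ (Fin d)} {t : ℝ}

theorem mollifier_nonneg (ht : 0 < t) (x : EuclideanSpace ℝ (Fin d)) : 0 ≤ mollifier x₀ t x :=
  mul_nonneg (by positivity) (unitBump_nonneg _)

theorem one_lt_norm_of_notMem_closedBall (ht : 0 < t) {x : EuclideanSpace ℝ (Fin d)}
    (hx : x ∉ Metric.closedBall x₀ t) : 1 < ‖t⁻¹ • (x - x₀)‖ := by
  rw [Metric.mem_closedBall, dist_eq_norm, not_le] at hx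
  rw [norm_smul, norm_inv, Real.norm_of_nonneg ht.le, ← div_eq_inv_mul, one_lt_div ht]
  exact hx

theorem mollifier_eq_zero (ht : 0 < t) {x : EuclideanSpace ℝ (Fin d)}
    (hx : x ∉ Metric.closedBall x₀ t) : mollifier x₀ t x = 0 := by
  rw [mollifier, unitBump_eq_zero (one_lt_norm_of_notMem_closedBall ht hx), mul_zero]

theorem contDiff_mollifier : ContDiff ℝ ∞ (mollifier x₀ t) :=
  contDiff_const.mul (contDiff_unitBump.comp ((contDiff_id.sub contDiff_const).const_smul _))

theorem continuous_mollifier : Continuous (mollifier x₀ t) :=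
  contDiff_mollifier.continuous

theorem abs_mollifier_le {B : ℝ} (hB : ∀ z, |unitBump d z| ≤ B) (ht : 0 < t)
    (x : EuclideanSpace ℝ (Fin d)) : |mollifier x₀ t x| ≤ (t ^ d)⁻¹ * B := by
  rw [mollifier, abs_mul, abs_of_nonneg (by positivity : (0 : ℝ) ≤ (t ^ d)⁻¹)]
  exact mul_le_mul_of_nonneg_left (hB _) (by positivity)

theorem integral_mollifier (ht : 0 < t) : ∫ x, mollifier x₀ t x = 1 := by
  simp only [mollifier]
  rw [integral_const_mul, integral_sub_right_eq_self (fun x => unitBump d (t⁻¹ • x)) x₀,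
    Measure.integral_comp_smul, integral_unitBump, finrank_euclideanSpace, Fintype.card_fin]
  have : 0 < t ^ d := by positivity
  simp [abs_of_pos ht, this.ne']

/-- The divergence of `z ↦ unitBump d z • z`. -/
noncomputable def divUnitBump (d : ℕ) (z : EuclideanSpace ℝ (Fin d)) : ℝ :=
  d * unitBump d z + fderiv ℝ (unitBump d) z z

theorem continuous_divUnitBump : Continuous (divUnitBump d) :=
  (continuous_const.mul contDiff_unitBump.continuous).add
    ((contDiff_unitBump.continuous_fderiv (by simp)).clm_apply continuous_id)

theorem divUnitBump_eq_zero {z : EuclideanSpace ℝ (Fin d)} (hz : 1 < ‖z‖) :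
    divUnitBump d z = 0 := by
  have : fderiv ℝ (unitBump d) z = 0 := by
    refine image_eq_zero_of_notMem_tsupport fun h => ?_
    have h2 := tsupport_fderiv_subset ℝ h
    rw [tsupport_unitBump, mem_closedBall_zero_iff] at h2
    exact (not_le.2 hz) h2
  rw [divUnitBump, unitBump_eq_zero hz, this]
  simp

theorem exists_divUnitBump_le (d : ℕ) : ∃ B : ℝ, 0 ≤ B ∧ ∀ z, |divUnitBump d z| ≤ B := by
  obtain ⟨C, hC⟩ := (isCompact_closedBall (0 : EuclideanSpace ℝ (Fin d)) 1).exists_bound_of_continuousOn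
    continuous_divUnitBump.continuousOn
  refine ⟨max C 0, le_max_right _ _, fun z => ?_⟩
  rcases le_or_gt ‖z‖ 1 with h | h
  · exact (hC z (mem_closedBall_zero_iff.2 h)).trans (le_max_left _ _)
  · rw [divUnitBump_eq_zero h, abs_zero]
    exact le_max_right _ _

/-- With `ρ` the unit bump and `z = t⁻¹ (x - x₀)`, differentiating `t^(-d) ρ(z)` in `t` gives
`-t^(-d-1) (d ρ(z) + ρ'(z) z)`, and the bracket is the divergence of `z ↦ ρ(z) z`. A change of scale
is therefore a divergence, which can be moved onto the weak gradient of `u`. -/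
theorem hasDerivAt_mollifier (ht : 0 < t) (x : EuclideanSpace ℝ (Fin d)) :
    HasDerivAt (fun τ => mollifier x₀ τ x)
      (-((t ^ (d + 1))⁻¹ * divUnitBump d (t⁻¹ • (x - x₀)))) t := by
  have h1 : HasDerivAt (fun τ : ℝ => τ⁻¹ • (x - x₀)) ((-(t ^ 2)⁻¹) • (x - x₀)) t :=
    (hasDerivAt_inv ht.ne').smul_const _
  have h2 := ((contDiff_unitBump (d := d)).differentiable (by simp)
    (t⁻¹ • (x - x₀))).hasFDerivAt.comp_hasDerivAt t h1
  have h3 : HasDerivAt (fun τ : ℝ => (τ ^ d)⁻¹) (-(d * (t ^ (d + 1))⁻¹)) t := by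
    refine ((hasDerivAt_pow d t).inv (by positivity)).congr_deriv ?_
    rcases d with _ | e
    · simp
    · rw [Nat.add_sub_cancel]
      field_simp
      ring
  refine (h3.mul h2).congr_deriv ?_
  simp only [divUnitBump, map_smul, smul_eq_mul, Function.comp_apply]
  field_simp
  ring

variable {Ω : Set (EuclideanSpace ℝ (Fin d))} {u : EuclideanSpace ℝ (Fin d) → ℝ}

theorem hasDerivAt_integral_mollifier (hu : Integrable u (volume.restrict Ω)) (ht : 0 < t) :
    HasDerivAt (fun τ => ∫ x in Ω, mollifier x₀ τ x * u x)
      (∫ x in Ω, -((t ^ (d + 1))⁻¹ * divUnitBump d (t⁻¹ • (x - x₀))) * u x) t := by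
  obtain ⟨B, hB0, hB⟩ := exists_divUnitBump_le d
  obtain ⟨B', -, hB'⟩ := exists_unitBump_le d
  -- Staying in `τ > t / 2` keeps `τ^(-(d+1))` bounded, which gives a dominating function
  -- independent of `τ`.
  refine (hasDerivAt_integral_of_dominated_loc_of_deriv_le (s := Ioi (t / 2))
    (bound := fun x => (((t / 2) ^ (d + 1))⁻¹ * B) * |u x|)
    (F := fun τ x => mollifier x₀ τ x * u x)
    (F' := fun τ x => -((τ ^ (d + 1))⁻¹ * divUnitBump d (τ⁻¹ • (x - x₀))) * u x)
    (Ioi_mem_nhds (by linarith)) ?_ ?_ ?_ ?_ (hu.abs.const_mul _) ?_).2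
  · exact Eventually.of_forall fun τ =>
      (continuous_mollifier (t := τ)).aestronglyMeasurable.mul hu.1
  · have hm : AEStronglyMeasurable (mollifier x₀ t) (volume.restrict Ω) :=
      continuous_mollifier.aestronglyMeasurable
    have hb : ∀ x, ‖mollifier x₀ t x‖ ≤ (t ^ d)⁻¹ * B' := abs_mollifier_le hB' ht
    exact hu.bdd_mul hm (Eventually.of_forall hb)
  · have h1 : Continuous fun x : EuclideanSpace ℝ (Fin d) => t⁻¹ • (x - x₀) := by fun_prop
    have h2 : Continuous fun x : EuclideanSpace ℝ (Fin d) =>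
        -((t ^ (d + 1))⁻¹ * divUnitBump d (t⁻¹ • (x - x₀))) :=
      (continuous_const.mul (continuous_divUnitBump.comp h1)).neg
    exact h2.aestronglyMeasurable.mul hu.1
  · refine Eventually.of_forall fun x τ hτ => ?_
    have hτ0 : t / 2 < τ := hτ
    have ht2 : 0 < t / 2 := by linarith
    have hτp : 0 < τ := by linarith
    rw [norm_mul, norm_neg, norm_mul, Real.norm_eq_abs (u x), norm_inv, norm_pow,
      Real.norm_of_nonneg hτp.le, Real.norm_eq_abs]
    gcongr
    exact hB _
  · refine Eventually.of_forall fun x τ hτ => ?_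
    have hτ0 : t / 2 < τ := hτ
    exact (hasDerivAt_mollifier (by linarith) x).mul_const _

/-- Testing the weak gradient with the radial fields `x ↦ unitBump d (t⁻¹ • (x - x₀)) • (x - x₀)`. -/
theorem IsWeakGradient.integral_divUnitBump
    {g : EuclideanSpace ℝ (Fin d) → EuclideanSpace ℝ (Fin d)} (h : IsWeakGradient Ω u g)
    (hu : Integrable u (volume.restrict Ω))
    (hg : Integrable g (volume.restrict Ω)) (ht : 0 < t)
    (hball : Metric.closedBall x₀ t ⊆ Ω) :
    ∫ x in Ω, divUnitBump d (t⁻¹ • (x - x₀)) * u x =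
      -∫ x in Ω, inner ℝ (g x) (x - x₀) * unitBump d (t⁻¹ • (x - x₀)) := by
  let ζ : EuclideanSpace ℝ (Fin d) → ℝ := fun x => unitBump d (t⁻¹ • (x - x₀))
  have hζ : ContDiff ℝ ∞ ζ :=
    contDiff_unitBump.comp ((contDiff_id.sub contDiff_const).const_smul _)
  have hζ0 : ∀ x ∉ Metric.closedBall x₀ t, ζ x = 0 := fun x hx =>
    unitBump_eq_zero (one_lt_norm_of_notMem_closedBall ht hx)
  have hζc : HasCompactSupport ζ := HasCompactSupport.intro (isCompact_closedBall x₀ t) hζ0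
  have hζs : tsupport ζ ⊆ Metric.closedBall x₀ t :=
    closure_minimal (fun x hx => by_contra fun h => hx (hζ0 x h)) Metric.isClosed_closedBall
  have hζd : ∀ x v, fderiv ℝ ζ x v = t⁻¹ * fderiv ℝ (unitBump d) (t⁻¹ • (x - x₀)) v :=
    fun x v => by
      have h1 : HasFDerivAt (fun y : EuclideanSpace ℝ (Fin d) => t⁻¹ • (y - x₀))
          (t⁻¹ • ContinuousLinearMap.id ℝ _) x := ((hasFDerivAt_id x).sub_const x₀).const_smul t⁻¹
      have h2 := ((contDiff_unitBump (d := d)).differentiable (by simp)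
        (t⁻¹ • (x - x₀))).hasFDerivAt.comp x h1
      have h3 : fderiv ℝ ζ x = _ := h2.fderiv
      rw [h3]
      simp
  -- The components of the radial field. The `i`-th one is tested against the `i`-th partial
  -- derivative, and the sum over `i` gives the divergence.
  let φ : Fin d → EuclideanSpace ℝ (Fin d) → ℝ := fun i x => (x - x₀) i * ζ x
  have hcoord : ∀ i, ContDiff ℝ ∞ fun x : EuclideanSpace ℝ (Fin d) => (x - x₀) i := fun i =>
    (EuclideanSpace.proj (𝕜 := ℝ) i).contDiff.comp (contDiff_id.sub contDiff_const)
  have hφ : ∀ i, ContDiff ℝ ∞ (φ i) := fun i => (hcoord i).mul hζ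
  have hφc : ∀ i, HasCompactSupport (φ i) := fun i => hζc.mul_left
  have hφs : ∀ i, tsupport (φ i) ⊆ Ω := fun i =>
    (tsupport_mul_subset_right).trans (hζs.trans hball)
  have hφd : ∀ i x, fderiv ℝ (φ i) x (EuclideanSpace.single i 1) =
      ζ x + (x - x₀) i * fderiv ℝ ζ x (EuclideanSpace.single i 1) := fun i x => by
    have h1 : HasFDerivAt (fun y : EuclideanSpace ℝ (Fin d) => (y - x₀) i)
        (EuclideanSpace.proj (𝕜 := ℝ) i) x :=
      (EuclideanSpace.proj (𝕜 := ℝ) i).hasFDerivAt.comp x ((hasFDerivAt_id x).sub_const x₀)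
    have h2 := h1.mul ((hζ.differentiable (by simp)) x).hasFDerivAt
    have h3 : fderiv ℝ (φ i) x = _ := h2.fderiv
    rw [h3]
    simp [add_comm]
  have hsum : ∀ x, ∑ i, fderiv ℝ (φ i) x (EuclideanSpace.single i 1) =
      divUnitBump d (t⁻¹ • (x - x₀)) := fun x => by
    have hx : x - x₀ = ∑ i, (x - x₀) i • EuclideanSpace.single i (1 : ℝ) := by
      simpa using ((EuclideanSpace.basisFun (Fin d) ℝ).sum_repr (x - x₀)).symm
    have h1 : fderiv ℝ ζ x (x - x₀) =
        ∑ i, (x - x₀) i * fderiv ℝ ζ x (EuclideanSpace.single i 1) := by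
      conv_lhs => rw [hx]
      simp only [map_sum, map_smul, smul_eq_mul]
    simp only [hφd, Finset.sum_add_distrib]
    -- The factor `t⁻¹` from the chain rule combines with `x - x₀` to the rescaled argument of
    -- `divUnitBump`.
    rw [← h1, hζd, divUnitBump, (fderiv ℝ (unitBump d) _).map_smul, smul_eq_mul]
    simp [ζ]
  have hint1 : ∀ i, Integrable (fun x => u x * fderiv ℝ (φ i) x (EuclideanSpace.single i 1))
      (volume.restrict Ω) := fun i => by
    have hc : Continuous fun x => fderiv ℝ (φ i) x (EuclideanSpace.single i 1) :=
      ((hφ i).continuous_fderiv (by simp)).clm_apply continuous_const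
    obtain ⟨C, hC⟩ := hc.bounded_above_of_compact_support ((hφc i).fderiv_apply (𝕜 := ℝ) _)
    exact hu.mul_bdd hc.aestronglyMeasurable (Eventually.of_forall hC)
  have hgi : ∀ i, Integrable (fun x => g x i) (volume.restrict Ω) := fun i =>
    (EuclideanSpace.proj (𝕜 := ℝ) i).integrable_comp hg
  have hint2 : ∀ i, Integrable (fun x => g x i * φ i x) (volume.restrict Ω) := fun i => by
    obtain ⟨C, hC⟩ := (hφ i).continuous.bounded_above_of_compact_support (hφc i)
    exact (hgi i).mul_bdd (hφ i).continuous.aestronglyMeasurable (Eventually.of_forall hC)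
  calc ∫ x in Ω, divUnitBump d (t⁻¹ • (x - x₀)) * u x
      = ∫ x in Ω, ∑ i, u x * fderiv ℝ (φ i) x (EuclideanSpace.single i 1) := by
        refine integral_congr_ae (Eventually.of_forall fun x => ?_)
        simp only
        rw [← hsum, ← Finset.mul_sum, mul_comm]
    _ = ∑ i, -∫ x in Ω, g x i * φ i x := by
        rw [integral_finsetSum _ fun i _ => hint1 i]
        exact Finset.sum_congr rfl fun i _ => h (φ i) (hφ i) (hφc i) (hφs i) i
    _ = -∫ x in Ω, ∑ i, g x i * φ i x := by
        rw [integral_finsetSum _ fun i _ => hint2 i, Finset.sum_neg_distrib]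
    _ = _ := by
        congr 1
        refine integral_congr_ae (Eventually.of_forall fun x => ?_)
        simp only [PiLp.inner_apply, φ, ζ, Finset.sum_mul]
        refine Finset.sum_congr rfl fun i _ => ?_
        simp
        ring

/-- The averages at two scales differ by at most the integral of the weak gradient. -/
theorem IsWeakGradient.abs_integral_mollifier_sub_le
    {g : EuclideanSpace ℝ (Fin d) → EuclideanSpace ℝ (Fin d)} (h : IsWeakGradient Ω u g)
    (hu : Integrable u (volume.restrict Ω))
    (hg : Integrable g (volume.restrict Ω)) {B : ℝ} (hB : ∀ z, |unitBump d z| ≤ B)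
    {a b : ℝ} (ha : 0 < a) (hab : a ≤ b) (hball : Metric.closedBall x₀ b ⊆ Ω) :
    |(∫ x in Ω, mollifier x₀ b x * u x) - ∫ x in Ω, mollifier x₀ a x * u x| ≤
      (a ^ d)⁻¹ * B * (∫ x in Metric.closedBall x₀ b, ‖g x‖) * (b - a) := by
  have hB0 : 0 ≤ B := (abs_nonneg _).trans (hB 0)
  have hgb : IntegrableOn g (Metric.closedBall x₀ b) :=
    hg.mono_measure (Measure.restrict_mono hball le_rfl)
  rw [← Real.norm_eq_abs]
  -- Mean value inequality in the scale; it remains to bound the derivative uniformly on `[a, b]`.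
  have key := (convex_Icc a b).norm_image_sub_le_of_norm_hasDerivWithin_le
    (f := fun τ => ∫ x in Ω, mollifier x₀ τ x * u x)
    (f' := fun t => ∫ x in Ω, -((t ^ (d + 1))⁻¹ * divUnitBump d (t⁻¹ • (x - x₀))) * u x)
    (C := (a ^ d)⁻¹ * B * (∫ x in Metric.closedBall x₀ b, ‖g x‖))
    (fun t ht => (hasDerivAt_integral_mollifier hu (ha.trans_le ht.1)).hasDerivWithinAt)
    ?_ (left_mem_Icc.2 hab) (right_mem_Icc.2 hab)
  · rwa [Real.norm_of_nonneg (sub_nonneg.2 hab)] at key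
  intro t ht
  have ht0 : 0 < t := ha.trans_le ht.1
  have e : ∀ x, -((t ^ (d + 1))⁻¹ * divUnitBump d (t⁻¹ • (x - x₀))) * u x =
      -(t ^ (d + 1))⁻¹ * (divUnitBump d (t⁻¹ • (x - x₀)) * u x) := fun x => by ring
  have hbt : Metric.closedBall x₀ t ⊆ Metric.closedBall x₀ b := Metric.closedBall_subset_closedBall ht.2
  simp only [e]
  rw [integral_const_mul, h.integral_divUnitBump hu hg ht0 (hbt.trans hball), neg_mul_neg,
    ← integral_const_mul, setIntegral_eq_integral_of_forall_compl_eq_zero,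
    ← setIntegral_eq_integral_of_forall_compl_eq_zero (s := Metric.closedBall x₀ b),
    ← integral_const_mul]
  · refine norm_integral_le_of_norm_le (hgb.norm.const_mul _) (Eventually.of_forall fun x => ?_)
    by_cases hx : x ∈ Metric.closedBall x₀ t
    -- On the support `‖x - x₀‖ ≤ t`, which absorbs one power of `t` and leaves `t^(-d) ≤ a^(-d)`.
    · have h1 : |inner ℝ (g x) (x - x₀)| ≤ ‖g x‖ * t := by
        refine (abs_real_inner_le_norm _ _).trans ?_
        rw [Metric.mem_closedBall, dist_eq_norm] at hx
        gcongr
      rw [norm_mul, norm_mul, norm_inv, norm_pow, Real.norm_of_nonneg ht0.le, Real.norm_eq_abs,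
        Real.norm_eq_abs]
      calc (t ^ (d + 1))⁻¹ * (|inner ℝ (g x) (x - x₀)| * |unitBump d (t⁻¹ • (x - x₀))|)
          ≤ (t ^ (d + 1))⁻¹ * ((‖g x‖ * t) * B) := by
            gcongr
            exact hB _
        _ = (t ^ d)⁻¹ * B * ‖g x‖ := by
            field_simp
            ring
        _ ≤ (a ^ d)⁻¹ * B * ‖g x‖ := by
            gcongr
            exact ht.1
    · rw [unitBump_eq_zero (one_lt_norm_of_notMem_closedBall ht0 hx)]
      simp only [mul_zero, norm_zero]
      positivity
  · intro x hx
    rw [unitBump_eq_zero (one_lt_norm_of_notMem_closedBall ht0 fun h => hx (hbt h))]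
    simp
  · intro x hx
    rw [unitBump_eq_zero (one_lt_norm_of_notMem_closedBall ht0 fun h => hx (hball (hbt h)))]
    simp

end Mollifier

/-! ### Comparison of the averages at the scales `r` and `r / 2` -/

section ScaleEstimate

variable {d : ℕ} {Ω : Set (EuclideanSpace ℝ (Fin d))} {s p : ℝ}

theorem volume_real_closedBall_eq (x₀ : EuclideanSpace ℝ (Fin d)) {r : ℝ} (hr : 0 ≤ r) :
    volume.real (Metric.closedBall x₀ r) =
      r ^ d * volume.real (Metric.ball (0 : EuclideanSpace ℝ (Fin d)) 1) := by
  rw [Measure.addHaar_real_closedBall _ _ hr, finrank_euclideanSpace, Fintype.card_fin]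

/-- Counts the powers of `r`: `-2d` from the two kernels, `d/p + s` from the diameter `2r`, and `2d
(1 - 1/p)` from Hölder on the product of two balls add up to `s - d/p`. Here `c` stands for the
volume of the unit ball and `X` for the seminorm. -/
theorem scale_identity_gagliardo {r c B X : ℝ} (hr : 0 < r) :
    (((r / 2) ^ d)⁻¹ * B) ^ 2 * (2 * r) ^ ((d : ℝ) / p + s) * (X * ((r ^ d * c) ^ 2) ^ (1 - 1 / p)) =
      (2 ^ d * B) ^ 2 * 2 ^ ((d : ℝ) / p + s) * (c ^ 2) ^ (1 - 1 / p) * r ^ (s - d / p) * X := by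
  have e1 : ((r / 2) ^ d)⁻¹ = 2 ^ d * r ^ (-(d : ℝ)) := by
    rw [div_pow, inv_div, Real.rpow_neg hr.le, Real.rpow_natCast, div_eq_mul_inv]
  have e2 : ((r ^ d * c) ^ 2) ^ (1 - 1 / p) = r ^ ((d : ℝ) * 2 * (1 - 1 / p)) * (c ^ 2) ^ (1 - 1 / p) := by
    rw [mul_pow, Real.mul_rpow (by positivity) (by positivity), ← pow_mul, ← Real.rpow_natCast,
      ← Real.rpow_mul hr.le]
    push_cast
    rfl
  have e3 : r ^ (s - d / p) = r ^ (-(d : ℝ)) * r ^ (-(d : ℝ)) * r ^ ((d : ℝ) / p + s) *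
      r ^ ((d : ℝ) * 2 * (1 - 1 / p)) := by
    rw [← Real.rpow_add hr, ← Real.rpow_add hr, ← Real.rpow_add hr]
    congr 1
    ring
  rw [e1, e2, e3, Real.mul_rpow (by norm_num) hr.le]
  ring

/-- The same count for `s = 1`: `-d` from the kernel, `d (1 - 1/p)` from Hölder on one ball, and `1`
from the length of the scale interval add up to `1 - d/p`. -/
theorem scale_identity_gradient {r c B X : ℝ} (hr : 0 < r) (hc : 0 ≤ c) :
    ((r / 2) ^ d)⁻¹ * B * (X * (r ^ d * c) ^ (1 - 1 / p)) * (r - r / 2) =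
      2 ^ d * B * (1 / 2) * c ^ (1 - 1 / p) * r ^ (1 - d / p) * X := by
  have e1 : ((r / 2) ^ d)⁻¹ = 2 ^ d * r ^ (-(d : ℝ)) := by
    rw [div_pow, inv_div, Real.rpow_neg hr.le, Real.rpow_natCast, div_eq_mul_inv]
  have e2 : (r ^ d * c) ^ (1 - 1 / p) = r ^ ((d : ℝ) * (1 - 1 / p)) * c ^ (1 - 1 / p) := by
    rw [Real.mul_rpow (by positivity) (by positivity), ← Real.rpow_natCast, ← Real.rpow_mul hr.le]
  have e3 : r ^ (1 - d / p) = r ^ (-(d : ℝ)) * r ^ ((d : ℝ) * (1 - 1 / p)) * r := by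
    nth_rw 4 [← Real.rpow_one r]
    rw [← Real.rpow_add hr, ← Real.rpow_add hr]
    congr 1
    ring
  rw [e1, e2, e3]
  ring

/-- The averages of a Sobolev function at the scales `r` and `r / 2`. -/
theorem exists_abs_integral_mollifier_sub_half_le [hp : Fact (1 < p)]
    [IsFiniteMeasure (volume.restrict Ω)]
    (hs0 : 0 < s) (x₀ : EuclideanSpace ℝ (Fin d)) :
    ∃ C : ℝ, 0 ≤ C ∧ ∀ r : ℝ, 0 < r → Metric.closedBall x₀ r ⊆ Ω → ∀ v : SobolevSpace Ω s p,
      |(∫ x in Ω, mollifier x₀ r x * SobolevSpace.toLp v x) -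
        ∫ x in Ω, mollifier x₀ (r / 2) x * SobolevSpace.toLp v x| ≤
        C * r ^ (s - d / p) * ‖v‖ := by
  obtain ⟨B, hB0, hB⟩ := exists_unitBump_le d
  set c := volume.real (Metric.ball (0 : EuclideanSpace ℝ (Fin d)) 1) with hc
  have hc0 : 0 ≤ c := measureReal_nonneg
  suffices h : ∃ C : ℝ, 0 ≤ C ∧ ∀ r : ℝ, 0 < r → Metric.closedBall x₀ r ⊆ Ω →
      ∀ v : SobolevSpace Ω s p,
      |(∫ x in Ω, mollifier x₀ r x * SobolevSpace.toLp v x) -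
        ∫ x in Ω, mollifier x₀ (r / 2) x * SobolevSpace.toLp v x| ≤
        C * r ^ (s - d / p) * (sobolevSeminorm Ω s p (SobolevSpace.toLp v)).toReal by
    obtain ⟨C, hC0, hC⟩ := h
    refine ⟨C, hC0, fun r hr hball v => (hC r hr hball v).trans ?_⟩
    exact mul_le_mul_of_nonneg_left (SobolevSpace.toReal_seminorm_le v) (by positivity)
  rcases eq_or_ne s 1 with rfl | hs
  · refine ⟨2 ^ d * B * (1 / 2) * c ^ (1 - 1 / p), by positivity, fun r hr hball v => ?_⟩
    have hv := SobolevSpace.seminorm_lt_top v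
    -- For `s = 1` the seminorm is an infimum over weak gradients. Any `y` strictly above the
    -- claimed bound leaves room for a nearly optimal gradient.
    refine le_of_forall_gt_imp_ge_of_dense fun y hy => ?_
    set D := 2 ^ d * B * (1 / 2) * c ^ (1 - 1 / p) * r ^ (1 - d / p) with hD
    have hD0 : 0 ≤ D := by positivity
    have key : ∀ g, MemLp g (ENNReal.ofReal p) (volume.restrict Ω) →
        IsWeakGradient Ω (SobolevSpace.toLp v) g →
        |(∫ x in Ω, mollifier x₀ r x * SobolevSpace.toLp v x) -
          ∫ x in Ω, mollifier x₀ (r / 2) x * SobolevSpace.toLp v x| ≤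
          D * (eLpNorm g (ENNReal.ofReal p) (volume.restrict Ω)).toReal := fun g hg hw => by
      refine (hw.abs_integral_mollifier_sub_le (SobolevSpace.integrable_toLp v)
        (hg.integrable Fact.out) hB (half_pos hr) (by linarith) hball).trans ?_
      rw [hD, ← scale_identity_gradient hr hc0]
      have hgb : MemLp g (ENNReal.ofReal p) (volume.restrict (Metric.closedBall x₀ r)) :=
        hg.mono_measure (Measure.restrict_mono hball le_rfl)
      have : IsFiniteMeasure (volume.restrict (Metric.closedBall x₀ r)) :=
        isFiniteMeasure_restrict.2 measure_closedBall_lt_top.ne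
      have h1 := integral_norm_le_eLpNorm_mul hp.out hgb
      rw [measureReal_restrict_apply_univ, volume_real_closedBall_eq x₀ hr.le] at h1
      refine mul_le_mul_of_nonneg_right (mul_le_mul_of_nonneg_left (h1.trans ?_) (by positivity))
        (by linarith)
      refine mul_le_mul_of_nonneg_right ?_ (by positivity)
      exact ENNReal.toReal_mono hg.2.ne
        (eLpNorm_mono_measure _ (Measure.restrict_mono hball le_rfl))
    -- Only `0 ≤ c` has been recorded, so `D = 0` is treated separately: there any weak gradient in
    -- `L^p` suffices, and division by `D` is avoided.
    rcases hD0.eq_or_lt with hDz | hDpos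
    · rw [← hDz, zero_mul] at hy
      have hsem := hv
      rw [sobolevSeminorm, if_pos rfl, iInf_lt_iff] at hsem
      obtain ⟨g, hg⟩ := hsem
      rw [iInf_lt_iff] at hg
      obtain ⟨hg, -⟩ := hg
      have := key g hg.1 hg.2
      rw [← hDz, zero_mul] at this
      exact this.trans hy.le
    · have h1 : sobolevSeminorm Ω 1 p (SobolevSpace.toLp v) < ENNReal.ofReal (y / D) := by
        rw [ENNReal.lt_ofReal_iff_toReal_lt hv.ne, lt_div_iff₀ hDpos, mul_comm]
        exact hy
      rw [sobolevSeminorm, if_pos rfl, iInf_lt_iff] at h1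
      obtain ⟨g, hg⟩ := h1
      rw [iInf_lt_iff] at hg
      obtain ⟨hg, hlt⟩ := hg
      refine (key g hg.1 hg.2).trans ?_
      rw [ENNReal.lt_ofReal_iff_toReal_lt hg.1.2.ne, lt_div_iff₀ hDpos, mul_comm] at hlt
      exact hlt.le
  · refine ⟨(2 ^ d * B) ^ 2 * 2 ^ ((d : ℝ) / p + s) * (c ^ 2) ^ (1 - 1 / p), by positivity,
      fun r hr hball v => ?_⟩
    have hv := SobolevSpace.seminorm_lt_top v
    rw [sobolevSeminorm, if_neg hs] at hv ⊢
    rw [← scale_identity_gagliardo hr, ← volume_real_closedBall_eq x₀ hr.le]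
    refine abs_integral_sub_integral_le_gagliardo hp.out hs0 measurableSet_closedBall hball
      measure_closedBall_lt_top.ne (fun x hx y hy => ?_) (by positivity)
      (SobolevSpace.integrable_toLp v) continuous_mollifier.measurable
      continuous_mollifier.measurable (fun x => (abs_mollifier_le hB hr x).trans ?_)
      (abs_mollifier_le hB (half_pos hr)) (fun x => mollifier_eq_zero hr)
      (fun x hx => mollifier_eq_zero (half_pos hr) fun h =>
        hx (Metric.closedBall_subset_closedBall (by linarith) h))
      (integral_mollifier hr) (integral_mollifier (half_pos hr)) hv
    · rw [← dist_eq_norm]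
      rw [Metric.mem_closedBall] at hx hy
      linarith [dist_triangle_right x y x₀]
    · gcongr
      linarith

end ScaleEstimate

/-! ### The Dirac functional as a tangent direction, and failure of polyhedricity -/

section NotPolyhedric

variable {d : ℕ} {Ω : Set (EuclideanSpace ℝ (Fin d))} {s p : ℝ} [hp : Fact (1 < p)]

open SobolevSpace

theorem tendsto_div_two_pow (R : ℝ) : Tendsto (fun n : ℕ => R / 2 ^ n) atTop (𝓝 0) :=
  tendsto_const_nhds.div_atTop (tendsto_pow_atTop_atTop_of_one_lt one_lt_two)

/-- The averages around a point converge in the norm of the dual space. -/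
theorem exists_tendsto_integralDual_mollifier [IsFiniteMeasure (volume.restrict Ω)]
    (hs0 : 0 < s) (hsp : (d : ℝ) < s * p) {x₀ : EuclideanSpace ℝ (Fin d)} {R : ℝ} (hR : 0 < R)
    (hball : Metric.closedBall x₀ R ⊆ Ω)
    (hm : ∀ t, MemLp (mollifier x₀ t) ⊤ (volume.restrict Ω)) :
    ∃ L : StrongDual ℝ (SobolevSpace Ω s p),
      Tendsto (fun n : ℕ => integralDual (mollifier x₀ (R / 2 ^ n)) (hm _)) atTop (𝓝 L) := by
  obtain ⟨C, hC0, hC⟩ := exists_abs_integral_mollifier_sub_half_le (Ω := Ω) (p := p) hs0 x₀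
  have hp0 : 0 < p := by linarith [hp.out]
  set θ : ℝ := s - d / p with hθ
  have hθ0 : 0 < θ := by
    rw [hθ, sub_pos, div_lt_iff₀ hp0]
    exact hsp
  -- At `r = R / 2 ^ n` the scale estimate reads `C R^θ ((1/2)^θ)^n`, and the ratio is less than one
  -- exactly because `θ = s - d/p > 0`. The estimate is linear in `‖v‖`, hence a bound in the dual
  -- norm, and the dual is complete.
  refine cauchySeq_tendsto_of_complete (cauchySeq_of_le_geometric ((1 / 2 : ℝ) ^ θ) (C * R ^ θ)
    (Real.rpow_lt_one (by norm_num) (by norm_num) hθ0) fun n => ?_)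
  rw [dist_eq_norm]
  refine ContinuousLinearMap.opNorm_le_bound _ (by positivity) fun v => ?_
  have hr : 0 < R / 2 ^ n := by positivity
  have hrR : R / 2 ^ n ≤ R := div_le_self hR.le (one_le_pow₀ one_le_two)
  have h := hC (R / 2 ^ n) hr ((Metric.closedBall_subset_closedBall hrR).trans hball) v
  rw [_root_.sub_apply, integralDual_apply, integralDual_apply, Real.norm_eq_abs,
    pow_succ, ← div_div]
  refine h.trans_eq ?_
  rw [div_eq_mul_inv, Real.mul_rpow hR.le (by positivity), ← Real.rpow_natCast, ← Real.rpow_natCast,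
    ← Real.rpow_mul (by norm_num), one_div, ← Real.inv_rpow (by norm_num), ← Real.rpow_mul (by norm_num),
    mul_comm θ, ← mul_assoc]

theorem mem_normalCone_of_forall_le {W : Type*} [NormedAddCommGroup W] [NormedSpace ℝ W]
    {K : Set W} {w : W} {η : StrongDual ℝ W} (h : ∀ k ∈ K, η k ≤ η w) : η ∈ normalCone K w := by
  intro x hx
  have hclosed : IsClosed {x | η x ≤ 0} := isClosed_le η.continuous continuous_const
  refine closure_minimal ?_ hclosed hx
  rintro y ⟨t, ht, k, hk, rfl⟩
  rw [mem_ofPred_eq, map_smul, map_sub, smul_eq_mul]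
  exact mul_nonpos_of_nonneg_of_nonpos ht.le (sub_nonpos.2 (h k hk))

theorem not_isPolyhedric_unitBoundsInDual (hd : 0 < d) (hΩ : IsOpen Ω)
    (hb : Bornology.IsBounded Ω) (hne : Ω.Nonempty) (hs0 : 0 < s) (hs1 : s ≤ 1)
    (hsp : (d : ℝ) < s * p) : ¬ IsPolyhedric (unitBoundsInDual Ω s p) := by
  have : IsFiniteMeasure (volume.restrict Ω) := isFiniteMeasure_restrict.2 hb.measure_lt_top.ne
  have : Nonempty (Fin d) := ⟨⟨0, hd⟩⟩
  have hp0 : 0 < p := by linarith [hp.out]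
  obtain ⟨x₀, hx₀⟩ := hne
  obtain ⟨R, hR, hball⟩ := Metric.nhds_basis_closedBall.mem_iff.1 (hΩ.mem_nhds hx₀)
  have hm : ∀ t, MemLp (mollifier x₀ t) ⊤ (volume.restrict Ω) := fun t =>
    memLp_of_continuous_of_isBounded hΩ hb continuous_mollifier ⊤
  have hone : MemLp (fun _ : EuclideanSpace ℝ (Fin d) => (1 : ℝ)) ⊤ (volume.restrict Ω) :=
    memLp_const 1
  let smooth : ∀ f : EuclideanSpace ℝ (Fin d) → ℝ, ContDiff ℝ 1 f → SobolevSpace Ω s p :=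
    fun f hf => ofFun f (memLp_of_continuous_of_isBounded hΩ hb hf.continuous _)
      (sobolevSeminorm_lt_top_of_contDiff hd hΩ hb hp0 hs1 hf)
  have hsmooth : ∀ f hf, toLp (smooth f hf) =ᵐ[volume.restrict Ω] f := fun f hf => toLp_ofFun _ _
  let one : SobolevSpace Ω s p := smooth (fun _ => 1) contDiff_const
  -- The choice of `v₀` has to meet two demands: positive a.e., so that no nonzero radial direction
  -- annihilates it, and zero at `x₀`, so that the Dirac functional does.
  have hv₀ : ContDiff ℝ 1 fun x : EuclideanSpace ℝ (Fin d) => ‖x - x₀‖ ^ 2 :=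
    (contDiff_id.sub contDiff_const).norm_sq ℝ
  let v₀ : SobolevSpace Ω s p := smooth _ hv₀
  let w : StrongDual ℝ (SobolevSpace Ω s p) := integralDual (fun _ => 1) hone
  let η : StrongDual ℝ (StrongDual ℝ (SobolevSpace Ω s p)) := ContinuousLinearMap.apply ℝ ℝ v₀
  have hw : w ∈ unitBoundsInDual Ω s p :=
    integralDual_mem_unitBoundsInDual hone (Eventually.of_forall fun x => by norm_num)
  have hint : ∀ q : Lp ℝ ⊤ (volume.restrict Ω),
      Integrable (fun x => (1 - q x) * toLp v₀ x) (volume.restrict Ω) := fun q =>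
    (integrable_toLp v₀).mul_of_top_right (hone.sub (Lp.memLp q))
  have hdiff : ∀ (k : StrongDual ℝ (SobolevSpace Ω s p)) (q : Lp ℝ ⊤ (volume.restrict Ω)),
      (∀ v, k v = ∫ x in Ω, q x * toLp v x) →
      η w - η k = ∫ x in Ω, (1 - q x) * toLp v₀ x := fun k q hk => by
    change w v₀ - k v₀ = _
    rw [integralDual_apply, hk, ← integral_sub]
    · refine integral_congr_ae (Eventually.of_forall fun x => ?_)
      simp only
      ring
    · simpa using integrable_toLp v₀
    · exact (integrable_toLp v₀).mul_of_top_right (Lp.memLp q)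
  have hnonneg : ∀ q : Lp ℝ ⊤ (volume.restrict Ω),
      (∀ᵐ x ∂(volume.restrict Ω), -1 ≤ q x ∧ q x ≤ 1) →
      0 ≤ᵐ[volume.restrict Ω] fun x => (1 - q x) * toLp v₀ x := fun q hq => by
    filter_upwards [hq, hsmooth _ hv₀] with x h1 h2
    rw [h2]
    exact mul_nonneg (by linarith [h1.2]) (by positivity)
  have hη : η ∈ normalCone (unitBoundsInDual Ω s p) w := by
    refine mem_normalCone_of_forall_le fun k hk => ?_
    obtain ⟨q, hq, hk⟩ := hk
    rw [← sub_nonneg, hdiff k q hk]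
    exact integral_nonneg_of_ae (hnonneg q hq)
  -- The nonnegative function `(1 - q) v₀` has integral zero, so it vanishes a.e.; as `v₀` is zero
  -- only at the null set `{x₀}`, `q = 1` a.e.
  have hzero : radialCone (unitBoundsInDual Ω s p) w ∩ annihilator η ⊆ {0} := by
    rintro _ ⟨⟨t, ht, k, ⟨q, hq, hk⟩, rfl⟩, h0⟩
    have h1 : η w - η k = 0 := by
      have h2 : η (t • (k - w)) = 0 := h0
      rw [map_smul, map_sub, smul_eq_mul, mul_eq_zero, or_iff_right ht.ne'] at h2
      linarith
    rw [hdiff k q hk, integral_eq_zero_iff_of_nonneg_ae (hnonneg q hq) (hint q)] at h1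
    have hq1 : ∀ᵐ x ∂(volume.restrict Ω), q x = 1 := by
      filter_upwards [h1, hsmooth _ hv₀, ae_restrict_of_ae (Measure.ae_ne volume x₀)] with x h1 h2 h3
      have h4 : (1 - q x) * toLp v₀ x = 0 := h1
      rw [h2, mul_eq_zero] at h4
      rcases h4 with h4 | h4
      · linarith
      · exact absurd (sub_eq_zero.1 (norm_eq_zero.1 (pow_eq_zero_iff two_ne_zero |>.1 h4))) h3
    have hkw : k = w := by
      ext v
      rw [hk, integralDual_apply]
      refine integral_congr_ae ?_
      filter_upwards [hq1] with x hx
      rw [hx]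
    rw [hkw, sub_self, smul_zero]
    rfl
  obtain ⟨L, hL⟩ := exists_tendsto_integralDual_mollifier hs0 hsp hR hball hm
  have htn : ∀ n : ℕ, 0 < R / 2 ^ n := fun n => by positivity
  have hballn : ∀ n : ℕ, Metric.closedBall x₀ (R / 2 ^ n) ⊆ Ω := fun n =>
    (Metric.closedBall_subset_closedBall (div_le_self hR.le (one_le_pow₀ one_le_two))).trans hball
  have hmass : ∀ n : ℕ, ∫ x in Ω, mollifier x₀ (R / 2 ^ n) x = 1 := fun n => by
    rw [setIntegral_eq_integral_of_forall_compl_eq_zero fun x hx =>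
      mollifier_eq_zero (htn n) fun h => hx (hballn n h), integral_mollifier (htn n)]
  have hLone : L one = 1 := by
    refine tendsto_nhds_unique (((ContinuousLinearMap.apply ℝ ℝ one).continuous.tendsto L).comp hL) ?_
    refine tendsto_const_nhds.congr fun n => ?_
    change 1 = integralDual (mollifier x₀ (R / 2 ^ n)) (hm _) one
    rw [integralDual_apply, ← hmass n]
    refine integral_congr_ae ?_
    filter_upwards [hsmooth (fun _ => 1) contDiff_const] with x hx
    change _ = _ * toLp (smooth (fun _ => 1) contDiff_const) x
    rw [hx, mul_one]
  -- On the support of the mollifier `v₀` is at most the square of the scale, and the mollifier has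
  -- mass one.
  have hLv₀ : L v₀ = 0 := by
    refine tendsto_nhds_unique (((ContinuousLinearMap.apply ℝ ℝ v₀).continuous.tendsto L).comp hL) ?_
    have hsq : Tendsto (fun n : ℕ => (R / 2 ^ n) ^ 2) atTop (𝓝 0) := by
      simpa using (tendsto_div_two_pow R).pow 2
    refine squeeze_zero_norm (fun n => ?_) hsq
    change ‖integralDual (mollifier x₀ (R / 2 ^ n)) (hm _) v₀‖ ≤ _
    have hmi : Integrable (mollifier x₀ (R / 2 ^ n)) (volume.restrict Ω) :=
      (hm _).integrable le_top
    rw [integralDual_apply, ← mul_one ((R / 2 ^ n) ^ 2), ← hmass n, ← integral_const_mul]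
    refine norm_integral_le_of_norm_le (hmi.const_mul _) ?_
    filter_upwards [hsmooth _ hv₀] with x hx
    rw [hx]
    by_cases h : x ∈ Metric.closedBall x₀ (R / 2 ^ n)
    · rw [Metric.mem_closedBall, dist_eq_norm] at h
      rw [Real.norm_of_nonneg (mul_nonneg (mollifier_nonneg (htn n) x) (by positivity)), mul_comm]
      exact mul_le_mul_of_nonneg_right (pow_le_pow_left₀ (norm_nonneg _) h 2)
        (mollifier_nonneg (htn n) x)
    · rw [mollifier_eq_zero (htn n) h]
      simp
  have hradial : ∀ n : ℕ, -integralDual (mollifier x₀ (R / 2 ^ n)) (hm _) ∈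
      radialCone (unitBoundsInDual Ω s p) w := fun n => by
    obtain ⟨B, hB0, hB⟩ := exists_unitBump_le d
    -- `T` bounds the mollifier `m` from above, so `q = 1 - m / T` takes values in `[0, 1]`, and `T
    -- (q - 1) = -m` is a radial direction.
    set T : ℝ := ((R / 2 ^ n) ^ d)⁻¹ * B with hT
    have hT0 : 0 < T := mul_pos (inv_pos.2 (pow_pos (htn n) d)) hB0
    have hq : MemLp (fun x => 1 - T⁻¹ * mollifier x₀ (R / 2 ^ n) x) ⊤ (volume.restrict Ω) :=
      hone.sub ((hm _).const_mul T⁻¹)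
    refine ⟨T, hT0, integralDual _ hq, integralDual_mem_unitBoundsInDual hq
      (Eventually.of_forall fun x => ?_), ?_⟩
    · have h1 := mollifier_nonneg (x₀ := x₀) (htn n) x
      have h2 : mollifier x₀ (R / 2 ^ n) x ≤ T :=
        (le_abs_self _).trans (abs_mollifier_le hB (htn n) x)
      have h3 : T⁻¹ * mollifier x₀ (R / 2 ^ n) x ≤ 1 := by
        rw [inv_mul_le_iff₀ hT0, mul_one]
        exact h2
      have h4 : 0 ≤ T⁻¹ * mollifier x₀ (R / 2 ^ n) x := by positivity
      constructor <;> linarith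
    · ext v
      have hi1 : Integrable (fun x => (1 - T⁻¹ * mollifier x₀ (R / 2 ^ n) x) * toLp v x)
          (volume.restrict Ω) := (integrable_toLp v).mul_of_top_right hq
      have hi2 : Integrable (fun x => 1 * toLp v x) (volume.restrict Ω) := by
        simpa using integrable_toLp v
      rw [_root_.neg_apply, _root_.smul_apply,
        _root_.sub_apply, integralDual_apply, integralDual_apply, integralDual_apply,
        ← integral_sub hi1 hi2, smul_eq_mul, ← integral_const_mul, ← integral_neg]
      refine integral_congr_ae (Eventually.of_forall fun x => ?_)
      simp only
      field_simp
      ring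
  intro hpoly
  have hmem : -L ∈ tangentCone (unitBoundsInDual Ω s p) w ∩ annihilator η := by
    refine ⟨mem_closure_of_tendsto hL.neg (Eventually.of_forall hradial), ?_⟩
    change (-L) v₀ = 0
    rw [_root_.neg_apply, hLv₀, neg_zero]
  rw [hpoly w hw η hη] at hmem
  -- Polyhedricity would place `-L` in the closure of a subset of `{0}`, contradicting `L one = 1`.
  have hL0 : -L = 0 := closure_minimal hzero isClosed_singleton hmem
  rw [neg_eq_zero] at hL0
  rw [hL0, _root_.zero_apply] at hLone
  exact zero_ne_one hLone

end NotPolyhedric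

theorem mainTheorem5 (d : ℕ) (hd : 0 < d) (Ω : Set (EuclideanSpace ℝ (Fin d)))
    (hΩ : IsBoundedLipschitzDomain Ω) (s p : ℝ) (hs0 : 0 < s) (hs1 : s ≤ 1)
    [Fact (1 < p)] (hsp : (d : ℝ) < s * p) :
    IsClosed (unitBoundsInDual Ω s p) ∧ Convex ℝ (unitBoundsInDual Ω s p) ∧
      (unitBoundsInDual Ω s p).Nonempty ∧ ¬ IsPolyhedric (unitBoundsInDual Ω s p) := by
  have : IsFiniteMeasure (volume.restrict Ω) :=
    isFiniteMeasure_restrict.2 hΩ.isBounded.measure_lt_top.ne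
  refine ⟨SobolevSpace.isClosed_unitBoundsInDual, SobolevSpace.convex_unitBoundsInDual,
    ⟨0, ?_⟩, not_isPolyhedric_unitBoundsInDual hd hΩ.isOpen hΩ.isBounded hΩ.isConnected.nonempty
      hs0 hs1 hsp⟩
  exact (SobolevSpace.mem_unitBoundsInDual_iff 0).2 fun v => norm_nonneg _
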